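/- **Setting.** There are three items $A,B,C$ with $A\succ C$, $B\succ C$, and $A,B$ incomparable. One buyer has a type $(v,G)$ (value $v\in[0,H]$, interest $G\in\{A,B,C\}$) and gets value $v$ if awarded $G$ or an item that dominates $G$, and $0$ otherwise. Types are drawn from a distribution on $[0,H]\times\{A,B,C\}$, $H>0$, with density $f_G(v)$; let $F_G(v)=\int_0^v f_G$, $q_G=F_G(H)$, and $f_G\varphi_G(v)=v f_G(v)-(q_G-F_G(v))$ (Myerson's virtual value times the density). **Mechanisms.** A direct mechanism $(a,p)$ gives a buyer reporting $(v,G)$ item $G$ with probability $a_G(v)\in[0,1]$ at price $p_G(v)$. It is optimal if it maximizes $\sum_G\int_0^H f_G p_G$ among the mechanisms in which truthful reporting is best for every type in $[0,H]\times\{A,B,C\}$ and gives nonnegative utility. Its menu complexity is the number of pairs $(G,q)$ with $a_G(v)=q$ for some $v\in[0,H]$. **Primal.** Write $u_G(v)=\int_0^v a_G$. An allocation rule $a$ is feasible if $a_G:[0,H]\to[0,1]$ is non-decreasing for every $G$ and $u_C\ge u_A$, $u_C\ge u_B$ on $[0,H]$; it is optimal if it maximizes $\sum_G\int_0^H f_G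 a_G\varphi_G$ among feasible rules. **Dual.** A dual $(\lambda,\alpha)$ consists of absolutely continuous $\lambda_G:[0,H]\to[0,\infty)$ with $\lambda_G(H)=0$ and finite positive measures $\alpha_{C,A},\alpha_{C,B}$ on $[0,H]$. Its virtual values are, for almost every $v$, $$f_G\Phi_G(v)=f_G\varphi_G(v)-\lambda_G'(v)-\alpha_{C,G}([v,H])\quad(G\in\{A,B\}),$$ $$f_C\Phi_C(v)=f_C\varphi_C(v)-\lambda_C'(v)+\alpha_{C,A}([v,H])+\alpha_{C,B}([v,H]).$$ It is optimal if it minimizes $\sum_G\int_0^H\max\{0,f_G\Phi_G(v)\}\,dv$. An ironed interval of item $G$ is a maximal interval on which $\lambda_G>0$; it has virtual value zero if $f_G\Phi_G=0$ almost everywhere on it. Let $\bar r_G$ be the least $r\in[0,H]$ such that $f_G\Phi_G>0$ almost everywhere on $(r,H)$. A *best dual* is an optimal dual that has the fewest ironed intervals of virtual value zero (counted over all three items) among optimal duals and, among those, the lexicographically smallest $(\bar r_A,\bar r_B,\bar r_C)$. **Complementary slackness** of $a$ and $(\lambda,\alpha)$: for every $G$ and almost every $v\in[0,H]$, $f_G\Phi_G(v)>0$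 implies $a_G(v)=1$ and $f_G\Phi_G(v)<0$ implies $a_G(v)=0$; for every $v\in[0,H]$ with $\lambda_G(v)>0$, $a_G'(v)=0$ (derivative relative to $[0,H]$); and for $G\in\{A,B\}$, $u_C(v)=u_G(v)$ for $\alpha_{C,G}$-almost every $v$. **Theorem.** For every such distribution: (i) for every best dual $(\lambda,\alpha)$ there is a feasible allocation rule $a$ of finite menu complexity that satisfies complementary slackness with $(\lambda,\alpha)$; moreover $a$ is an optimal primal solution, and with the payments $p_G(v)=v a_G(v)-\int_0^v a_G$ it is an optimal mechanism. (ii) There is an optimal mechanism of finite menu complexity. -/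

import Mathlib

open MeasureTheory Set

noncomputable section

/-- The three items. `A` and `B` are incomparable and both dominate `C`. -/
inductive Item where
  | A
  | B
  | C
  deriving DecidableEq

namespace Item

/-- `G'.Satisfies G`: a buyer interested in `G` is content with `G'`, that is `G' ⪰ G`. -/
def Satisfies (G' G : Item) : Prop := G' = G ∨ G = C

/-- Sum over the three items. -/
def total (x : Item → ℝ) : ℝ := x A + x B + x C

end Item

/-- A three-item instance: a joint distribution of (value, interest) on `[0, H] × {A, B, C}`,
given by its density `f G v`. -/
structure AuctionInstance where
  H : ℝ
  H_pos : 0 < H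
  f : Item → ℝ → ℝ
  f_nonneg : ∀ G, ∀ v ∈ Icc 0 H, 0 ≤ f G v
  f_integrable : ∀ G, IntegrableOn (f G) (Icc 0 H)
  f_total : Item.total (fun G => ∫ v in (0 : ℝ)..H, f G v) = 1

/-- A direct mechanism: a buyer who reports `(v, G)` gets item `G` with probability `alloc G v`
and pays `pay G v`. -/
structure Mechanism where
  alloc : Item → ℝ → ℝ
  pay : Item → ℝ → ℝ

/-- Utility `u_G(v) = ∫₀^v a_G` of the allocation rule `a`. -/
def utility (a : Item → ℝ → ℝ) (G : Item) (v : ℝ) : ℝ := ∫ w in (0 : ℝ)..v, a G w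

/-- The mechanism with allocation rule `a` and the payments
`p_G(v) = v a_G(v) - ∫₀^v a_G` determined by it. -/
def Mechanism.ofAlloc (a : Item → ℝ → ℝ) : Mechanism where
  alloc := a
  pay G v := v * a G v - utility a G v

open scoped Classical in
/-- Utility of a buyer of type `(v, G)` who reports `(v', G')` to the mechanism `M`. -/
def Mechanism.payoff (M : Mechanism) (v : ℝ) (G : Item) (v' : ℝ) (G' : Item) : ℝ :=
  (if G'.Satisfies G then v * M.alloc G' v' else 0) - M.pay G' v'

namespace AuctionInstance

variable (I : AuctionInstance)

/-- Probability `q_G` that the buyer's interest is `G`. -/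
def q (G : Item) : ℝ := ∫ v in (0 : ℝ)..I.H, I.f G v

/-- `F_G(v) = ∫₀^v f_G`, which increases from `0` to `q_G`. -/
def F (G : Item) (v : ℝ) : ℝ := ∫ w in (0 : ℝ)..v, I.f G w

/-- `f_G(v) φ_G(v)`, where `φ_G(v) = v - (q_G - F_G(v)) / f_G(v)` is Myerson's virtual value of the
conditional distribution with distribution function `F_G / q_G`. -/
def myerson (G : Item) (v : ℝ) : ℝ := v * I.f G v - (I.q G - I.F G v)

/-- The menu of an allocation rule: the pairs `(G, q)` with `a_G(v) = q` for some `v ∈ [0, H]`. -/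
def menu (a : Item → ℝ → ℝ) : Set (Item × ℝ) := {m | ∃ v ∈ Icc 0 I.H, a m.1 v = m.2}

/-- Menu complexity: the number of elements of the menu. -/
def menuComplexity (a : Item → ℝ → ℝ) : ℕ∞ := (I.menu a).encard

/-! ### Truthful mechanisms -/

/-- Admissible mechanisms: probabilities in `[0, 1]`, truth-telling is optimal for every type, and
no truthful type has negative utility. -/
structure IsTruthful (M : Mechanism) : Prop where
  alloc_mem : ∀ G, ∀ v ∈ Icc 0 I.H, M.alloc G v ∈ Icc (0 : ℝ) 1
  incentiveCompatible : ∀ G G', ∀ v ∈ Icc 0 I.H, ∀ v' ∈ Icc 0 I.H,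
    M.payoff v G v' G' ≤ M.payoff v G v G
  individuallyRational : ∀ G, ∀ v ∈ Icc 0 I.H, 0 ≤ M.payoff v G v G

/-- Expected revenue under truthful reports. -/
def revenue (M : Mechanism) : ℝ :=
  Item.total (fun G => ∫ v in (0 : ℝ)..I.H, I.f G v * M.pay G v)

/-- Revenue-optimal mechanisms. -/
def IsOptimalMechanism (M : Mechanism) : Prop :=
  I.IsTruthful M ∧ ∀ M', I.IsTruthful M' → I.revenue M' ≤ I.revenue M

/-! ### The primal linear program -/

/-- Feasible primal solutions. -/
structure IsFeasible (a : Item → ℝ → ℝ) : Prop where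
  mem : ∀ G, ∀ v ∈ Icc 0 I.H, a G v ∈ Icc (0 : ℝ) 1
  monotone : ∀ G, MonotoneOn (a G) (Icc 0 I.H)
  utility_A : ∀ v ∈ Icc 0 I.H, utility a Item.A v ≤ utility a Item.C v
  utility_B : ∀ v ∈ Icc 0 I.H, utility a Item.B v ≤ utility a Item.C v

/-- The primal objective `∑_G ∫₀^H f_G a_G φ_G`. -/
def primalValue (a : Item → ℝ → ℝ) : ℝ :=
  Item.total (fun G => ∫ v in (0 : ℝ)..I.H, a G v * I.myerson G v)

/-- Optimal primal solutions. -/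
def IsOptimalPrimal (a : Item → ℝ → ℝ) : Prop :=
  I.IsFeasible a ∧ ∀ a', I.IsFeasible a' → I.primalValue a' ≤ I.primalValue a

end AuctionInstance

/-- A dual solution `(lam, α)`. The multipliers `lam G` of the monotonicity constraints are
nonnegative, absolutely continuous and vanish at `H`. The multipliers `α_{C,A}`, `α_{C,B}` of the
constraints `u_C ≥ u_A`, `u_C ≥ u_B` are finite measures on `[0, H]`, so that the flow may have a
density and may also be concentrated at single points. -/
structure DualSolution (I : AuctionInstance) where
  lam : Item → ℝ → ℝ
  lam_nonneg : ∀ G, ∀ v ∈ Icc 0 I.H, 0 ≤ lam G v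
  lam_ac : ∀ G, AbsolutelyContinuousOnInterval (lam G) 0 I.H
  lam_H : ∀ G, lam G I.H = 0
  flowA : Measure ℝ
  flowB : Measure ℝ
  flowA_finite : IsFiniteMeasure flowA
  flowB_finite : IsFiniteMeasure flowB
  flowA_supp : flowA (Icc 0 I.H)ᶜ = 0
  flowB_supp : flowB (Icc 0 I.H)ᶜ = 0

namespace DualSolution

variable {I : AuctionInstance} (d : DualSolution I)

/-- Net flow out of item `G` at values at least `v`. -/
def netOutflow (G : Item) (v : ℝ) : ℝ :=
  match G with
  | Item.A => -d.flowA.real (Icc v I.H)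
  | Item.B => -d.flowB.real (Icc v I.H)
  | Item.C => d.flowA.real (Icc v I.H) + d.flowB.real (Icc v I.H)

/-- The virtual value `f_G(v) Φ_G(v)`, defined for almost every `v ∈ [0, H]`. -/
def virtualValue (G : Item) (v : ℝ) : ℝ :=
  I.myerson G v - deriv (d.lam G) v + d.netOutflow G v

/-- The value of the Lagrangian relaxation, `∑_G ∫₀^H f_G max(0, Φ_G)`. -/
def value : ℝ :=
  Item.total (fun G => ∫ v in (0 : ℝ)..I.H, max 0 (d.virtualValue G v))

/-- Optimal duals. -/
def IsOptimal : Prop := ∀ d' : DualSolution I, d.value ≤ d'.value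

/-- Lower endpoint of the ironed interval containing `x` in `G`. -/
def lowerEnd (G : Item) (x : ℝ) : ℝ := sSup {v | v ∈ Icc 0 x ∧ d.lam G v = 0}

/-- Upper endpoint of the ironed interval containing `x` in `G`. -/
def upperEnd (G : Item) (x : ℝ) : ℝ := sInf {v | v ∈ Icc x I.H ∧ d.lam G v = 0}

/-- The ironed intervals of virtual value zero, each given by its item and its lower endpoint. -/
def zeroIronedIntervals : Set (Item × ℝ) :=
  {p | ∃ x ∈ Icc 0 I.H, 0 < d.lam p.1 x ∧ d.lowerEnd p.1 x = p.2 ∧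
    ∀ᵐ v : ℝ, v ∈ Ioo (d.lowerEnd p.1 x) (d.upperEnd p.1 x) → d.virtualValue p.1 v = 0}

/-- The number of ironed intervals of virtual value zero. -/
def ironedCount : ℕ∞ := d.zeroIronedIntervals.encard

/-- The top endpoint `r̄_G` of the zero region: the essential supremum of the values at which the
virtual value is nonpositive, that is the least point above which it is almost everywhere
positive. -/
def rbar (G : Item) : ℝ :=
  sInf {r | r ∈ Icc 0 I.H ∧ ∀ᵐ v : ℝ, v ∈ Ioo r I.H → 0 < d.virtualValue G v}

/-- The triple `(r̄_A, r̄_B, r̄_C)`, to be compared lexicographically. -/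
def positives : ℝ ×ₗ (ℝ ×ₗ ℝ) :=
  toLex (d.rbar Item.A, toLex (d.rbar Item.B, d.rbar Item.C))

/-- Optimal duals with the fewest ironed intervals of virtual value zero. -/
def HasFewestIronedIntervals : Prop :=
  d.IsOptimal ∧ ∀ d' : DualSolution I, d'.IsOptimal → d.ironedCount ≤ d'.ironedCount

/-- Best duals: among the optimal duals with the fewest ironed intervals of virtual value zero,
those with the lexicographically lowest positives. -/
def IsBest : Prop :=
  d.HasFewestIronedIntervals ∧
    ∀ d' : DualSolution I, d'.HasFewestIronedIntervals → d.positives ≤ d'.positives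

/-- Complementary slackness between an allocation rule `a` and the dual `d`. -/
structure ComplementarySlackness (a : Item → ℝ → ℝ) (d : DualSolution I) : Prop where
  positive : ∀ G, ∀ᵐ v : ℝ, v ∈ Icc 0 I.H → 0 < d.virtualValue G v → a G v = 1
  negative : ∀ G, ∀ᵐ v : ℝ, v ∈ Icc 0 I.H → d.virtualValue G v < 0 → a G v = 0
  ironed : ∀ G, ∀ v ∈ Icc 0 I.H, 0 < d.lam G v → HasDerivWithinAt (a G) 0 (Icc 0 I.H) v
  flow_A : ∀ᵐ v ∂d.flowA, utility a Item.C v = utility a Item.A v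
  flow_B : ∀ᵐ v ∂d.flowB, utility a Item.C v = utility a Item.B v

end DualSolution

end

/-!
The primal program is a linear program over triples of monotone functions `[0, H] → [0, 1]`, which
form a compact set for pointwise convergence on which the objective and the utilities are continuous
(`continuousOn_integral_mul`). Three facts about it give the theorem.

*Some optimal allocation rule has finitely many values* (`exists_optimal_finite`). By Krein–Milman
there is an optimal `a` that is a vertex of the feasible set. If an interval meets the price
distributions of only two of the items, `a` is finitely valued near any accumulation point in it.
Indeed, where a utility constraint is slack, four distinct values of `a` leave room for a
perturbation `a ± ψ ∘ a` that keeps the utilities at the ends of the interval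
(`IsVertex.finite_image_of_slack`); and at the points where `u_C = u_X` the values of `a X` and of
`a C` interlace, so that one and the same `ψ` perturbs both items and merely rescales `u_C - u_X`
(`IsVertex.finite_image_touch`). If on the other hand the prices of all three items accumulate at
`p` from one side, cut a piece of small equal mass near `p` out of each price distribution, taking
the piece of `C` above the other two. What remains is still feasible after rescaling, so by
optimality the pieces are on average worth at least the optimum (`exists_localized_of_lt`). As they
shrink to `p`, posting the single price `p` for every item is seen to be optimal.

*Strong duality* (`exists_dual_value_le`). By compactness finitely many utility constraints suffice
up to `ε`; Hahn–Banach in finite dimension provides multipliers for them, which are point masses of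
the flow. The multiplier `lam` of monotonicity is explicit: it is the difference between the running
maximum of the integrated virtual value and that integral itself (`exists_ironing`).

*Complementary slackness* (`DualSolution.complementarySlackness_of_value_le`). An optimal dual is
worth no more than the optimal `a`, so every nonnegative term by which weak duality could be strict
vanishes. The layer-cake formula `le_integral_mul_of_tail` turns the vanishing of `-∫ a lam'` into
local constancy of `a` where `lam > 0`.

Myerson's payment identity and the envelope formula identify optimal allocation rules with optimal
mechanisms.
-/

noncomputable section

open Filter Topology

/-! ### Monotone functions and their integrals -/

/-- The non-decreasing functions `ℝ → [0, 1]`. Allocation rules are taken to be defined and monotone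
on all of `ℝ`, so that perturbing them does not require care at the ends of `[0, H]`. -/
def monotoneUnit : Set (ℝ → ℝ) := {b | Monotone b ∧ ∀ v, b v ∈ Icc (0 : ℝ) 1}

theorem isCompact_monotoneUnit : IsCompact monotoneUnit := by
  have h : IsCompact (univ.pi fun _ : ℝ => Icc (0 : ℝ) 1) :=
    isCompact_univ_pi fun _ => isCompact_Icc
  have hc : IsClosed {b : ℝ → ℝ | Monotone b} := by
    have : {b : ℝ → ℝ | Monotone b} = ⋂ (v : ℝ) (w : ℝ) (_ : v ≤ w), {b | b v ≤ b w} := by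
      ext b; simp [Monotone]
    rw [this]
    exact isClosed_iInter fun v => isClosed_iInter fun w => isClosed_iInter fun _ =>
      isClosed_le (continuous_apply v) (continuous_apply w)
  refine (h.inter_left hc).of_isClosed_subset ?_ ?_
  · have : monotoneUnit = {b : ℝ → ℝ | Monotone b} ∩ univ.pi fun _ : ℝ => Icc (0 : ℝ) 1 := by
      ext b
      exact ⟨fun h => ⟨h.1, fun v _ => h.2 v⟩, fun h => ⟨h.1, fun v => h.2 v (mem_univ v)⟩⟩
    rw [this]
    exact hc.inter h.isClosed
  · exact fun b hb => ⟨hb.1, fun v _ => hb.2 v⟩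

theorem monotoneUnit.norm_le {b : ℝ → ℝ} (hb : b ∈ monotoneUnit) (v : ℝ) : ‖b v‖ ≤ 1 := by
  rw [Real.norm_eq_abs, abs_le]
  exact ⟨by linarith [(hb.2 v).1], (hb.2 v).2⟩

theorem monotoneUnit.intervalIntegrable {b : ℝ → ℝ} (hb : b ∈ monotoneUnit) (x y : ℝ) :
    IntervalIntegrable b volume x y :=
  hb.1.intervalIntegrable

theorem monotoneUnit.intervalIntegrable_mul {b g : ℝ → ℝ} (hb : b ∈ monotoneUnit) {x y : ℝ}
    (hg : IntervalIntegrable g volume x y) :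
    IntervalIntegrable (fun v => b v * g v) volume x y :=
  ⟨hg.1.bdd_mul hb.1.measurable.aestronglyMeasurable (.of_forall (monotoneUnit.norm_le hb)),
    hg.2.bdd_mul hb.1.measurable.aestronglyMeasurable (.of_forall (monotoneUnit.norm_le hb))⟩

/-- On a cell `[x, y]` a monotone weight may be replaced by its value at `x`, with an error bounded
by its increment times the mass of `|g|`. -/
theorem abs_integral_mul_sub_le {b g : ℝ → ℝ} (hb : b ∈ monotoneUnit) {x y : ℝ} (hxy : x ≤ y)
    (hg : IntervalIntegrable g volume x y) :
    |(∫ v in x..y, b v * g v) - b x * ∫ v in x..y, g v|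
      ≤ (b y - b x) * ∫ v in x..y, |g v| := by
  rw [← intervalIntegral.integral_const_mul, ← intervalIntegral.integral_const_mul,
    ← intervalIntegral.integral_sub (monotoneUnit.intervalIntegrable_mul hb hg) (hg.const_mul _),
    ← Real.norm_eq_abs]
  refine (intervalIntegral.norm_integral_le_integral_norm hxy).trans ?_
  refine intervalIntegral.integral_mono_on hxy
    ((monotoneUnit.intervalIntegrable_mul hb hg).sub (hg.const_mul _)).norm
    (hg.abs.const_mul _) fun v hv => ?_
  rw [← sub_mul, norm_mul, Real.norm_eq_abs, Real.norm_eq_abs,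
    abs_of_nonneg (sub_nonneg.2 (hb.1 hv.1))]
  have := hb.1 hv.2
  gcongr

/-- For a fixed integrable `g`, the functional `b ↦ ∫ b g` is continuous for *pointwise*
convergence of monotone functions: its Riemann–Stieltjes sums converge uniformly in `b`. -/
theorem continuousOn_integral_mul {g : ℝ → ℝ} {L : ℝ} (hL : 0 ≤ L)
    (hg : IntervalIntegrable g volume 0 L) :
    ContinuousOn (fun b : ℝ → ℝ => ∫ v in (0 : ℝ)..L, b v * g v) monotoneUnit := by
  let t : ℕ → ℕ → ℝ := fun n i => i * (L / (n + 1))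
  let P : ℕ → (ℝ → ℝ) → ℝ := fun n b =>
    ∑ i ∈ Finset.range (n + 1), b (t n i) * ∫ v in (t n i)..(t n (i + 1)), g v
  have hP : ∀ n, Continuous (P n) := fun n =>
    continuous_finsetSum _ fun i _ => (continuous_apply _).mul continuous_const
  have hstep : ∀ n i, t n (i + 1) - t n i = L / (n + 1) := fun n i => by
    simp only [t]; push_cast; ring
  have hle : ∀ n i, t n i ≤ t n (i + 1) := fun n i => by
    have : (0 : ℝ) ≤ L / (n + 1) := by positivity
    linarith [hstep n i]
  have ht0 : ∀ n, t n 0 = 0 := fun n => by simp [t]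
  have htn : ∀ n, t n (n + 1) = L := fun n => by
    simp only [t]; push_cast; field_simp
  have hmem : ∀ n i, i ≤ n + 1 → t n i ∈ Icc 0 L := fun n i hi => by
    have hm : Monotone (t n) := monotone_nat_of_le_succ (hle n)
    exact ⟨(ht0 n) ▸ hm (Nat.zero_le i), (htn n) ▸ hm hi⟩
  have hII : ∀ n i, i < n + 1 → IntervalIntegrable g volume (t n i) (t n (i + 1)) :=
    fun n i hi => hg.mono_set (by
      rw [uIcc_of_le (hle n i), uIcc_of_le hL]
      exact Icc_subset_Icc (hmem n i hi.le).1 (hmem n (i + 1) hi).2)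
  refine TendstoUniformlyOn.continuousOn (F := P) (p := atTop) ?_
    (Frequently.of_forall fun n => (hP n).continuousOn)
  rw [Metric.tendstoUniformlyOn_iff]
  intro ε hε
  have hW : ContinuousOn (fun v => ∫ w in (0 : ℝ)..v, |g w|) (Icc 0 L) := by
    have := intervalIntegral.continuousOn_primitive_interval (a := 0) (b := L) (μ := volume)
      (f := fun w => |g w|) (by
        rw [uIcc_of_le hL]; exact (intervalIntegrable_iff_integrableOn_Icc_of_le hL).1 hg.abs)
    rwa [uIcc_of_le hL] at this
  have hU := isCompact_Icc.uniformContinuousOn_of_continuous hW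
  rw [Metric.uniformContinuousOn_iff] at hU
  obtain ⟨δ, hδ, hU⟩ := hU (ε / 2) (half_pos hε)
  have hlim : Tendsto (fun n : ℕ => L / ((n : ℝ) + 1)) atTop (𝓝 0) := by
    have := tendsto_one_div_add_atTop_nhds_zero_nat (𝕜 := ℝ)
    simpa [div_eq_mul_inv] using this.const_mul L
  filter_upwards [hlim.eventually (gt_mem_nhds hδ)] with n hn b hb
  have hcell : ∀ i < n + 1, ∫ v in (t n i)..(t n (i + 1)), |g v| ≤ ε / 2 := fun i hi => by
    have h1 := hU _ (hmem n (i + 1) hi) _ (hmem n i hi.le) (by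
      rw [Real.dist_eq, hstep, abs_of_nonneg (by positivity)]; exact hn)
    rw [Real.dist_eq, intervalIntegral.integral_interval_sub_left] at h1
    · exact (le_abs_self _).trans h1.le
    all_goals
      refine hg.abs.mono_set ?_
      rw [uIcc_of_le hL]
      refine uIcc_subset_Icc ⟨le_rfl, hL⟩ (hmem n _ (by omega))
  have hsum : ∫ v in (0 : ℝ)..L, b v * g v
      = ∑ i ∈ Finset.range (n + 1), ∫ v in (t n i)..(t n (i + 1)), b v * g v := by
    rw [intervalIntegral.sum_integral_adjacent_intervals
      (fun i hi => monotoneUnit.intervalIntegrable_mul hb (hII n i hi)), ht0, htn]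
  rw [Real.dist_eq, hsum, ← Finset.sum_sub_distrib]
  calc |∑ i ∈ Finset.range (n + 1), ((∫ v in (t n i)..(t n (i + 1)), b v * g v)
          - b (t n i) * ∫ v in (t n i)..(t n (i + 1)), g v)|
      ≤ ∑ i ∈ Finset.range (n + 1), (b (t n (i + 1)) - b (t n i)) * (ε / 2) := by
        refine (Finset.abs_sum_le_sum_abs _ _).trans (Finset.sum_le_sum fun i hi => ?_)
        have hi := Finset.mem_range.1 hi
        exact (abs_integral_mul_sub_le hb (hle n i) (hII n i hi)).trans
          (mul_le_mul_of_nonneg_left (hcell i hi) (sub_nonneg.2 (hb.1 (hle n i))))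
    _ = (b L - b 0) * (ε / 2) := by
        rw [← Finset.sum_mul, Finset.sum_range_sub (fun i => b (t n i)), htn, ht0]
    _ < ε := by
        have := (hb.2 L).2
        have := (hb.2 0).1
        nlinarith

theorem continuousOn_integral {L : ℝ} (hL : 0 ≤ L) :
    ContinuousOn (fun b : ℝ → ℝ => ∫ v in (0 : ℝ)..L, b v) monotoneUnit := by
  simpa using continuousOn_integral_mul (g := fun _ => 1) hL (by simp)

/-- Exchanging the order of integration between a monotone weight `b` and a finite measure `α` on
`[0, H]`: weighting `b` by the tails of `α` amounts to integrating the primitive of `b`. -/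
theorem integral_mul_tail {b : ℝ → ℝ} (hb : b ∈ monotoneUnit) {L : ℝ} (hL : 0 ≤ L)
    (α : Measure ℝ) [IsFiniteMeasure α] (hα : α (Icc 0 L)ᶜ = 0) :
    ∫ w in (0 : ℝ)..L, b w * α.real (Icc w L) = ∫ v, (∫ w in (0 : ℝ)..v, b w) ∂α := by
  have hae : ∀ᵐ v ∂α, v ∈ Icc 0 L := by rwa [ae_iff]
  have hmeas : Measurable (fun p : ℝ × ℝ => (if p.1 ≤ p.2 then b p.1 else 0)) :=
    Measurable.ite (measurableSet_le measurable_fst measurable_snd)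
      (hb.1.measurable.comp measurable_fst) measurable_const
  have hint : Integrable (Function.uncurry fun w v : ℝ => (if w ≤ v then b w else 0))
      ((volume.restrict (Ioc 0 L)).prod α) := by
    refine Integrable.of_bound hmeas.aestronglyMeasurable 1 (.of_forall fun p => ?_)
    simp only [Function.uncurry]
    split_ifs
    · exact monotoneUnit.norm_le hb _
    · simp
  have hswap := integral_integral_swap hint
  have h1 : ∫ w in (0 : ℝ)..L, b w * α.real (Icc w L)
      = ∫ w in Ioc 0 L, ∫ v, (if w ≤ v then b w else 0) ∂α := by
    rw [intervalIntegral.integral_of_le hL]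
    refine setIntegral_congr_fun measurableSet_Ioc fun w _ => ?_
    have h2 : (fun v => if w ≤ v then b w else 0) = (Ici w).indicator fun _ => b w := by
      ext v; simp [indicator]
    have h3 : α.real (Ici w) = α.real (Icc w L) := by
      refine measureReal_congr ?_
      filter_upwards [hae] with v hv
      exact propext ⟨fun h => ⟨h, hv.2⟩, fun h => h.1⟩
    simp only [h2]
    rw [integral_indicator measurableSet_Ici, setIntegral_const, h3, smul_eq_mul, mul_comm]
  rw [h1, hswap]
  refine integral_congr_ae ?_
  filter_upwards [hae] with v hv
  have h2 : (fun w => if w ≤ v then b w else 0) = (Iic v).indicator b := by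
    ext w; simp [indicator]
  rw [h2, setIntegral_indicator measurableSet_Iic, Ioc_inter_Iic, min_eq_right hv.2,
    intervalIntegral.integral_of_le hv.1]

/-- The part of `[0, H]` where a monotone function exceeds a level is, up to a null set, an
interval with right endpoint `H`. -/
theorem exists_setIntegral_superlevel {b : ℝ → ℝ} (hb : Monotone b) {L : ℝ} (hL : 0 ≤ L)
    (s : ℝ) (g : ℝ → ℝ) :
    ∃ τ ∈ Icc 0 L, (∀ v ∈ Icc 0 L, s < b v → τ ≤ v) ∧ (∀ v ∈ Icc 0 L, b v ≤ s → v ≤ τ) ∧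
      ∫ w in Ioc 0 L, (if s < b w then g w else 0) = ∫ w in τ..L, g w := by
  let S : Set ℝ := insert L {v | v ∈ Icc 0 L ∧ s < b v}
  have hS0 : ∀ v ∈ S, 0 ≤ v := by
    rintro v (rfl | hv)
    exacts [hL, hv.1.1]
  have hbdd : BddBelow S := ⟨0, hS0⟩
  have hne : S.Nonempty := ⟨L, mem_insert _ _⟩
  have h0 : 0 ≤ sInf S := le_csInf hne hS0
  have h1 : sInf S ≤ L := csInf_le hbdd (mem_insert _ _)
  refine ⟨sInf S, ⟨h0, h1⟩, fun v hv hs => csInf_le hbdd (Or.inr ⟨hv, hs⟩), ?_, ?_⟩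
  · intro v hv hs
    refine le_csInf hne ?_
    rintro w (rfl | hw)
    · exact hv.2
    · by_contra hlt
      exact absurd (hb (not_le.1 hlt).le) (not_le.2 (hs.trans_lt hw.2))
  · have hset : (fun w => if s < b w then g w else 0) = {w | s < b w}.indicator g := by
      ext w; simp [indicator]
    have hms : MeasurableSet {w | s < b w} := measurableSet_lt measurable_const hb.measurable
    rw [hset, setIntegral_indicator hms, intervalIntegral.integral_of_le h1]
    refine setIntegral_congr_set ?_
    have hn : ∀ᵐ w : ℝ, w ≠ sInf S := by simp [ae_iff]
    filter_upwards [hn] with w hw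
    refine propext ⟨fun h => ⟨?_, h.1.2⟩, fun h => ⟨⟨h0.trans_lt h.1, h.2⟩, ?_⟩⟩
    · exact lt_of_le_of_ne (csInf_le hbdd (Or.inr ⟨⟨h.1.1.le, h.1.2⟩, h.2⟩)) hw.symm
    · obtain ⟨x, hx, hxw⟩ := exists_lt_of_csInf_lt hne h.1
      rcases hx with rfl | hx
      · exact absurd hxw (not_lt.2 h.2)
      · exact hx.2.trans_le (hb hxw.le)

/-- Layer-cake lower bound: if all integrals of `g` over upper intervals are nonnegative, so is the
integral of `g` against a monotone weight `b`; and if those starting in `[x, y]` are at least `c`,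
the increase of `b` over `[x, y]` contributes at least `c` times as much. -/
theorem le_integral_mul_of_tail {b g : ℝ → ℝ} (hb : b ∈ monotoneUnit) {L : ℝ} (hL : 0 ≤ L)
    (hg : IntervalIntegrable g volume 0 L) (h0 : ∀ t ∈ Icc 0 L, 0 ≤ ∫ w in t..L, g w)
    {x y c : ℝ} (hx : x ∈ Icc 0 L) (hy : y ∈ Icc 0 L) (hxy : x ≤ y)
    (hc : ∀ t ∈ Icc x y, c ≤ ∫ w in t..L, g w) :
    c * (b y - b x) ≤ ∫ w in (0 : ℝ)..L, b w * g w := by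
  have hgi : Integrable g (volume.restrict (Ioc 0 L)) := hg.1
  have hmeas : MeasurableSet {p : ℝ × ℝ | p.2 < b p.1} :=
    measurableSet_lt measurable_snd (hb.1.measurable.comp measurable_fst)
  have hint : Integrable (Function.uncurry fun w s : ℝ => (if s < b w then g w else 0))
      ((volume.restrict (Ioc 0 L)).prod (volume.restrict (Ioc (0 : ℝ) 1))) := by
    have h1 : Integrable (fun p : ℝ × ℝ => g p.1)
        ((volume.restrict (Ioc 0 L)).prod (volume.restrict (Ioc (0 : ℝ) 1))) :=
      hgi.comp_fst _
    refine (h1.indicator hmeas).congr (.of_forall fun p => ?_)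
    simp [indicator, Function.uncurry]
  have hswap := integral_integral_swap hint
  have hin : ∀ w, ∫ s in Ioc (0 : ℝ) 1, (if s < b w then g w else 0) = b w * g w := fun w => by
    have h2 : (fun s => if s < b w then g w else 0) = (Iio (b w)).indicator fun _ => g w := by
      ext s; simp [indicator]
    rw [h2, setIntegral_indicator measurableSet_Iio, setIntegral_const, smul_eq_mul]
    congr 1
    have h3 : Ioc (0 : ℝ) 1 ∩ Iio (b w) = Ioo 0 (b w) := by
      ext s
      have := (hb.2 w).2
      simp only [mem_inter_iff, mem_Ioc, mem_Iio, mem_Ioo]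
      exact ⟨fun h => ⟨h.1.1, h.2⟩, fun h => ⟨⟨h.1, by linarith [h.2]⟩, h.2⟩⟩
    rw [h3, Real.volume_real_Ioo_of_le (hb.2 w).1, sub_zero]
  simp only [hin] at hswap
  rw [intervalIntegral.integral_of_le hL, hswap]
  have hJ := hint.integral_prod_right
  have hlow : ∀ s, (Ioc (b x) (b y)).indicator (fun _ => c) s 
      ≤ ∫ w in Ioc 0 L, (if s < b w then g w else 0) ∨ s = b y := fun s => by
    obtain ⟨τ, hτ, hτ1, hτ2, hτ3⟩ := exists_setIntegral_superlevel hb.1 hL s g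
    rw [hτ3]
    by_cases hs : s ∈ Ioc (b x) (b y)
    · rcases hs.2.eq_or_lt with h | h
      · exact Or.inr h
      · rw [indicator_of_mem hs]
        exact Or.inl (hc τ ⟨hτ2 x hx hs.1.le, hτ1 y hy h⟩)
    · rw [indicator_of_notMem hs]
      exact Or.inl (h0 τ hτ)
  have hmon := hb.1 hxy
  have hcalc : c * (b y - b x)
      = ∫ s in Ioc (0 : ℝ) 1, (Ioc (b x) (b y)).indicator (fun _ => c) s := by
    rw [setIntegral_indicator measurableSet_Ioc, setIntegral_const, smul_eq_mul, mul_comm]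
    congr 1
    rw [inter_eq_right.2 (Ioc_subset_Ioc (hb.2 x).1 (hb.2 y).2), Real.volume_real_Ioc_of_le hmon]
  rw [hcalc]
  refine integral_mono_ae ?_ hJ ?_
  · exact (integrable_const c).indicator measurableSet_Ioc
  · have hn : ∀ᵐ s : ℝ ∂(volume.restrict (Ioc (0 : ℝ) 1)), s ≠ b y :=
      ae_restrict_of_ae (by simp [ae_iff])
    filter_upwards [hn] with s hs
    exact (hlow s).resolve_right hs

/-! ### Truthful mechanisms and the primal program -/

theorem Item.total_congr {x y : Item → ℝ} (h : ∀ G, x G = y G) : Item.total x = Item.total y := by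
  simp [Item.total, h]

theorem Item.total_le_total {x y : Item → ℝ} (h : ∀ G, x G ≤ y G) :
    Item.total x ≤ Item.total y := by
  simp only [Item.total]; linarith [h A, h B, h C]

theorem Item.total_add (x y : Item → ℝ) :
    Item.total (fun G => x G + y G) = Item.total x + Item.total y := by
  simp only [Item.total]; ring

theorem Item.total_mul_left (c : ℝ) (x : Item → ℝ) :
    Item.total (fun G => c * x G) = c * Item.total x := by
  simp only [Item.total]; ring

section Envelope

variable {b : ℝ → ℝ} {L : ℝ}

theorem intervalIntegrable_of_monotoneOn_Icc (hb : MonotoneOn b (Icc 0 L)) {v w : ℝ}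
    (hv : v ∈ Icc 0 L) (hw : w ∈ Icc 0 L) : IntervalIntegrable b volume v w :=
  (hb.mono (uIcc_subset_Icc hv hw)).intervalIntegrable

theorem mul_le_integral_of_monotoneOn (hb : MonotoneOn b (Icc 0 L)) {v w : ℝ}
    (hv : v ∈ Icc 0 L) (hw : w ∈ Icc 0 L) (hvw : v ≤ w) :
    (w - v) * b v ≤ ∫ x in v..w, b x := by
  have := intervalIntegral.integral_mono_on hvw (f := fun _ => b v) (g := b) (by simp)
    (intervalIntegrable_of_monotoneOn_Icc hb hv hw)
    (fun x hx => hb hv ⟨hv.1.trans hx.1, hx.2.trans hw.2⟩ hx.1)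
  simpa using this

theorem integral_le_mul_of_monotoneOn (hb : MonotoneOn b (Icc 0 L)) {v w : ℝ}
    (hv : v ∈ Icc 0 L) (hw : w ∈ Icc 0 L) (hvw : v ≤ w) :
    ∫ x in v..w, b x ≤ (w - v) * b w := by
  have := intervalIntegral.integral_mono_on hvw (g := fun _ => b w) (f := b)
    (intervalIntegrable_of_monotoneOn_Icc hb hv hw) (by simp)
    (fun x hx => hb ⟨hv.1.trans hx.1, hx.2.trans hw.2⟩ hw hx.2)
  simpa using this

theorem integral_sub_integral_of_monotoneOn (hb : MonotoneOn b (Icc 0 L)) {v w : ℝ}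
    (hv : v ∈ Icc 0 L) (hw : w ∈ Icc 0 L) :
    (∫ x in (0 : ℝ)..w, b x) - ∫ x in (0 : ℝ)..v, b x = ∫ x in v..w, b x := by
  have h0 : (0 : ℝ) ∈ Icc 0 L := ⟨le_rfl, hv.1.trans hv.2⟩
  exact intervalIntegral.integral_interval_sub_left
    (intervalIntegrable_of_monotoneOn_Icc hb h0 hw) (intervalIntegrable_of_monotoneOn_Icc hb h0 hv)

/-- The primitive of a monotone function lies above its supporting lines. -/
theorem primitive_add_mul_le (hb : MonotoneOn b (Icc 0 L)) {v w : ℝ}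
    (hv : v ∈ Icc 0 L) (hw : w ∈ Icc 0 L) :
    (∫ x in (0 : ℝ)..w, b x) + (v - w) * b w ≤ ∫ x in (0 : ℝ)..v, b x := by
  rcases le_total v w with h | h
  · have h1 := integral_sub_integral_of_monotoneOn hb hv hw
    have h2 := integral_le_mul_of_monotoneOn hb hv hw h
    linarith
  · have h1 := integral_sub_integral_of_monotoneOn hb hw hv
    have h2 := mul_le_integral_of_monotoneOn hb hw hv h
    linarith

/-- Envelope formula: a function with monotone subgradient `b` is a primitive of `b`. -/
theorem sub_eq_integral_of_subgradient {U : ℝ → ℝ} (hb : MonotoneOn b (Icc 0 L))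
    (hU : ∀ v ∈ Icc 0 L, ∀ w ∈ Icc 0 L, U w + (v - w) * b w ≤ U v) {v : ℝ} (hv : v ∈ Icc 0 L) :
    U v - U 0 = ∫ x in (0 : ℝ)..v, b x := by
  set D : ℝ → ℝ := fun v => U v - ∫ x in (0 : ℝ)..v, b x with hD
  have hstep : ∀ x ∈ Icc 0 L, ∀ y ∈ Icc 0 L, x ≤ y → |D y - D x| ≤ (b y - b x) * (y - x) := by
    intro x hx y hy hxy
    have h1 := integral_sub_integral_of_monotoneOn hb hx hy
    have h2 := integral_le_mul_of_monotoneOn hb hx hy hxy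
    have h3 := mul_le_integral_of_monotoneOn hb hx hy hxy
    have h4 := hU x hx y hy
    have h5 := hU y hy x hx
    rw [abs_le]
    simp only [hD]
    constructor <;> nlinarith
  have hbound : ∀ n : ℕ, |D v - D 0| ≤ ((b v - b 0) * v) * (1 / ((n : ℝ) + 1)) := by
    intro n
    let t : ℕ → ℝ := fun i => i * (v / (n + 1))
    have hs : ∀ i, t (i + 1) - t i = v / (n + 1) := fun i => by
      simp only [t]; push_cast; ring
    have hpos : 0 ≤ v / ((n : ℝ) + 1) := div_nonneg hv.1 (by positivity)
    have hm : Monotone t := monotone_nat_of_le_succ fun i => by linarith [hs i]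
    have ht0 : t 0 = 0 := by simp [t]
    have htn : t (n + 1) = v := by simp only [t]; push_cast; field_simp
    have hmem : ∀ i ≤ n + 1, t i ∈ Icc 0 L := fun i hi =>
      ⟨ht0 ▸ hm (Nat.zero_le i), (htn ▸ hm hi : t i ≤ v).trans hv.2⟩
    have h1 : D v - D 0 = ∑ i ∈ Finset.range (n + 1), (D (t (i + 1)) - D (t i)) := by
      rw [Finset.sum_range_sub (fun i => D (t i)), ht0, htn]
    rw [h1]
    refine (Finset.abs_sum_le_sum_abs _ _).trans ?_
    calc ∑ i ∈ Finset.range (n + 1), |D (t (i + 1)) - D (t i)|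
        ≤ ∑ i ∈ Finset.range (n + 1), (b (t (i + 1)) - b (t i)) * (v / (n + 1)) := by
          refine Finset.sum_le_sum fun i hi => ?_
          have hi := Finset.mem_range.1 hi
          rw [← hs i]
          exact hstep _ (hmem i hi.le) _ (hmem (i + 1) hi) (hm (Nat.le_succ i))
      _ = ((b v - b 0) * v) * (1 / ((n : ℝ) + 1)) := by
          rw [← Finset.sum_mul, Finset.sum_range_sub (fun i => b (t i)), ht0, htn]; ring
  have hlim := (tendsto_one_div_add_atTop_nhds_zero_nat (𝕜 := ℝ)).const_mul ((b v - b 0) * v)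
  rw [mul_zero] at hlim
  have h0 : |D v - D 0| ≤ 0 := ge_of_tendsto' hlim hbound
  have h1 : D v - D 0 = 0 := abs_nonpos_iff.1 h0
  simp only [hD, intervalIntegral.integral_same] at h1
  linarith

end Envelope

namespace AuctionInstance

variable (I : AuctionInstance)

theorem intervalIntegrable_f (G : Item) : IntervalIntegrable (I.f G) volume 0 I.H :=
  (intervalIntegrable_iff_integrableOn_Icc_of_le I.H_pos.le).2 (I.f_integrable G)

theorem continuousOn_F (G : Item) : ContinuousOn (I.F G) (uIcc 0 I.H) :=
  ((I.intervalIntegrable_f G).absolutelyContinuousOnInterval_intervalIntegral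
    (c := 0) left_mem_uIcc).continuousOn

theorem intervalIntegrable_myerson (G : Item) :
    IntervalIntegrable (I.myerson G) volume 0 I.H := by
  have h1 : IntervalIntegrable (fun v => v * I.f G v) volume 0 I.H :=
    (I.intervalIntegrable_f G).continuousOn_mul continuousOn_id
  have h2 : IntervalIntegrable (fun v => I.q G - I.F G v) volume 0 I.H :=
    (continuousOn_const.sub (I.continuousOn_F G)).intervalIntegrable
  exact h1.sub h2

/-- Myerson's payment identity: the revenue of the envelope payments is the virtual surplus. -/
theorem integral_f_mul_payment (G : Item) {b : ℝ → ℝ} (hb : MonotoneOn b (Icc 0 I.H)) :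
    ∫ v in (0 : ℝ)..I.H, I.f G v * (v * b v - ∫ w in (0 : ℝ)..v, b w)
      = ∫ v in (0 : ℝ)..I.H, b v * I.myerson G v := by
  have hH := I.H_pos.le
  have hf := I.intervalIntegrable_f G
  have h0 : (0 : ℝ) ∈ Icc 0 I.H := ⟨le_rfl, hH⟩
  have hL : I.H ∈ Icc 0 I.H := ⟨hH, le_rfl⟩
  have hbi := intervalIntegrable_of_monotoneOn_Icc hb h0 hL
  have hF := hf.absolutelyContinuousOnInterval_intervalIntegral (c := 0) left_mem_uIcc
  have hU := hbi.absolutelyContinuousOnInterval_intervalIntegral (c := 0) left_mem_uIcc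
  have hparts := hU.integral_mul_deriv_eq_deriv_mul hF
  have e1 : ∫ v in (0 : ℝ)..I.H, (∫ w in (0 : ℝ)..v, b w) *
        deriv (fun x => ∫ w in (0 : ℝ)..x, I.f G w) v
      = ∫ v in (0 : ℝ)..I.H, I.f G v * ∫ w in (0 : ℝ)..v, b w := by
    refine intervalIntegral.integral_congr_ae ?_
    filter_upwards [hf.ae_hasDerivAt_integral] with v hv hv'
    rw [(hv (uIoc_subset_uIcc hv') 0 left_mem_uIcc).deriv, mul_comm]
  have e2 : ∫ v in (0 : ℝ)..I.H, deriv (fun x => ∫ w in (0 : ℝ)..x, b w) v *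
        (∫ w in (0 : ℝ)..v, I.f G w)
      = ∫ v in (0 : ℝ)..I.H, b v * I.F G v := by
    refine intervalIntegral.integral_congr_ae ?_
    filter_upwards [hbi.ae_hasDerivAt_integral] with v hv hv'
    rw [(hv (uIoc_subset_uIcc hv') 0 left_mem_uIcc).deriv]
    rfl
  rw [e1, e2] at hparts
  have hbf : IntervalIntegrable (fun v => I.f G v * (v * b v)) volume 0 I.H := by
    have hbd : ∀ v ∈ Icc 0 I.H, ‖b v‖ ≤ max |b 0| |b I.H| := fun v hv =>
      abs_le_max_abs_abs (hb h0 hv hv.1) (hb hv hL hv.2)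
    have h1 : IntervalIntegrable (fun v => v * I.f G v) volume 0 I.H :=
      hf.continuousOn_mul continuousOn_id
    rw [intervalIntegrable_iff_integrableOn_Icc_of_le hH] at h1 hbi ⊢
    refine (h1.mul_bdd (c := max |b 0| |b I.H|) hbi.aestronglyMeasurable ?_).congr
      (.of_forall fun v => by ring)
    exact (ae_restrict_iff' measurableSet_Icc).2 (.of_forall hbd)
  have hfU : IntervalIntegrable (fun v => I.f G v * ∫ w in (0 : ℝ)..v, b w) volume 0 I.H :=
    hf.mul_continuousOn hU.continuousOn
  have hbF : IntervalIntegrable (fun v => b v * I.F G v) volume 0 I.H :=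
    hbi.mul_continuousOn hF.continuousOn
  have hbq : IntervalIntegrable (fun v => b v * I.q G) volume 0 I.H := hbi.mul_const _
  have hl : ∫ v in (0 : ℝ)..I.H, I.f G v * (v * b v - ∫ w in (0 : ℝ)..v, b w)
      = (∫ v in (0 : ℝ)..I.H, I.f G v * (v * b v))
        - ∫ v in (0 : ℝ)..I.H, I.f G v * ∫ w in (0 : ℝ)..v, b w := by
    rw [← intervalIntegral.integral_sub hbf hfU]
    simp only [mul_sub]
  have hr : ∫ v in (0 : ℝ)..I.H, b v * I.myerson G v
      = (∫ v in (0 : ℝ)..I.H, I.f G v * (v * b v)) - ((∫ v in (0 : ℝ)..I.H, b v * I.q G)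
        - ∫ v in (0 : ℝ)..I.H, b v * I.F G v) := by
    rw [← intervalIntegral.integral_sub hbq hbF, ← intervalIntegral.integral_sub hbf (hbq.sub hbF)]
    refine intervalIntegral.integral_congr fun v _ => ?_
    simp only [myerson]; ring
  rw [hl, hr, hparts, intervalIntegral.integral_mul_const]
  simp only [intervalIntegral.integral_same, q]
  ring

variable {I}

theorem utility_nonneg {a : Item → ℝ → ℝ} (ha : I.IsFeasible a) (G : Item) {v : ℝ}
    (hv : v ∈ Icc 0 I.H) : 0 ≤ utility a G v :=
  intervalIntegral.integral_nonneg hv.1 fun x hx => (ha.mem G x ⟨hx.1, hx.2.trans hv.2⟩).1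

theorem IsFeasible.utility_le {a : Item → ℝ → ℝ} (ha : I.IsFeasible a) (G : Item) {v : ℝ}
    (hv : v ∈ Icc 0 I.H) : utility a G v ≤ utility a Item.C v := by
  cases G
  exacts [ha.utility_A v hv, ha.utility_B v hv, le_rfl]

theorem isTruthful_ofAlloc {a : Item → ℝ → ℝ} (ha : I.IsFeasible a) :
    I.IsTruthful (Mechanism.ofAlloc a) := by
  have htrue : ∀ v G, (Mechanism.ofAlloc a).payoff v G v G = utility a G v := fun v G => by
    simp [Mechanism.payoff, Mechanism.ofAlloc, Item.Satisfies]
  refine ⟨ha.mem, fun G G' v hv v' hv' => ?_, fun G v hv => ?_⟩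
  · rw [htrue]
    have hline := primitive_add_mul_le (ha.monotone G') hv hv'
    by_cases hs : G'.Satisfies G
    · have hle : utility a G' v ≤ utility a G v := by
        rcases hs with rfl | rfl
        exacts [le_rfl, ha.utility_le G' hv]
      simp only [Mechanism.payoff, Mechanism.ofAlloc, if_pos hs]
      simp only [utility] at hle ⊢
      linarith
    · have h0 : (0 : ℝ) ∈ Icc 0 I.H := ⟨le_rfl, I.H_pos.le⟩
      have hline0 := primitive_add_mul_le (ha.monotone G') h0 hv'
      have hnn := utility_nonneg ha G hv
      simp only [intervalIntegral.integral_same] at hline0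
      simp only [Mechanism.payoff, Mechanism.ofAlloc, if_neg hs]
      simp only [utility] at hnn ⊢
      linarith
  · rw [htrue]
    exact utility_nonneg ha G hv

theorem revenue_ofAlloc {a : Item → ℝ → ℝ} (ha : I.IsFeasible a) :
    I.revenue (Mechanism.ofAlloc a) = I.primalValue a :=
  Item.total_congr fun G => I.integral_f_mul_payment G (ha.monotone G)

/-- The truthful utilities of the three items agree at value `0`: a buyer interested in `C` can
imitate the others, and at value `0` any buyer can claim to be interested in `C`. Hence the
allocation rule of a truthful mechanism is feasible, and its revenue is at most the virtual
surplus. -/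
theorem IsTruthful.isFeasible_and_revenue_le {M : Mechanism} (hM : I.IsTruthful M) :
    I.IsFeasible M.alloc ∧ I.revenue M ≤ I.primalValue M.alloc := by
  have h0 : (0 : ℝ) ∈ Icc 0 I.H := ⟨le_rfl, I.H_pos.le⟩
  set U : Item → ℝ → ℝ := fun G v => v * M.alloc G v - M.pay G v with hUdef
  have htrue : ∀ v G, M.payoff v G v G = U G v := fun v G => by
    simp [Mechanism.payoff, Item.Satisfies, hUdef]
  have hsub : ∀ G, ∀ v ∈ Icc 0 I.H, ∀ w ∈ Icc 0 I.H, U G w + (v - w) * M.alloc G w ≤ U G v := by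
    intro G v hv w hw
    have := hM.incentiveCompatible G G v hv w hw
    rw [htrue] at this
    simp only [Mechanism.payoff, Item.Satisfies, true_or, if_true] at this
    simp only [hUdef] at this ⊢
    linarith
  have hmono : ∀ G, MonotoneOn (M.alloc G) (Icc 0 I.H) := by
    intro G v hv w hw hvw
    rcases hvw.eq_or_lt with rfl | hlt
    · exact le_rfl
    · have h1 := hsub G v hv w hw
      have h2 := hsub G w hw v hv
      nlinarith
  have henv : ∀ G, ∀ v ∈ Icc 0 I.H, U G v - U G 0 = utility M.alloc G v := fun G v hv =>
    sub_eq_integral_of_subgradient (hmono G) (hsub G) hv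
  have hUC : ∀ G, ∀ v ∈ Icc 0 I.H, U G v ≤ U Item.C v := by
    intro G v hv
    have := hM.incentiveCompatible Item.C G v hv v hv
    rw [htrue] at this
    simp only [Mechanism.payoff, Item.Satisfies, or_true, if_true] at this
    exact this
  have hU0 : ∀ G, U G 0 = U Item.C 0 := by
    intro G
    refine le_antisymm (hUC G 0 h0) ?_
    have := hM.incentiveCompatible G Item.C 0 h0 0 h0
    rw [htrue] at this
    simpa [Mechanism.payoff, hUdef] using this
  have hle : ∀ G, ∀ v ∈ Icc 0 I.H, utility M.alloc G v ≤ utility M.alloc Item.C v := by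
    intro G v hv
    rw [← henv G v hv, ← henv Item.C v hv, hU0 G]
    linarith [hUC G v hv]
  have hfeas : I.IsFeasible M.alloc := ⟨hM.alloc_mem, hmono, hle Item.A, hle Item.B⟩
  refine ⟨hfeas, Item.total_le_total fun G => ?_⟩
  have hUnn : 0 ≤ U G 0 := by
    rw [← htrue]; exact hM.individuallyRational G 0 h0
  rw [← I.integral_f_mul_payment G (hmono G)]
  have hH := I.H_pos.le
  have hf := I.intervalIntegrable_f G
  have hbi := intervalIntegrable_of_monotoneOn_Icc (hmono G) h0 ⟨hH, le_rfl⟩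
  have hUac := hbi.absolutelyContinuousOnInterval_intervalIntegral (c := 0) left_mem_uIcc
  have hpay : ∀ v ∈ Icc 0 I.H, M.pay G v
      = (v * M.alloc G v - ∫ w in (0 : ℝ)..v, M.alloc G w) - U G 0 := by
    intro v hv
    have := henv G v hv
    simp only [utility, hUdef] at this ⊢
    linarith
  have hint : IntervalIntegrable
      (fun v => I.f G v * (v * M.alloc G v - ∫ w in (0 : ℝ)..v, M.alloc G w)) volume 0 I.H := by
    have hc : ContinuousOn (fun v : ℝ => v) (uIcc 0 I.H) := continuousOn_id
    have h1 := (hf.continuousOn_mul hc).1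
    rw [intervalIntegrable_iff_integrableOn_Ioc_of_le hH] at hbi
    have h2 : IntervalIntegrable (fun v => I.f G v * (v * M.alloc G v)) volume 0 I.H := by
      rw [intervalIntegrable_iff_integrableOn_Ioc_of_le hH]
      refine (h1.mul_bdd (c := 1) hbi.aestronglyMeasurable ?_).congr (.of_forall fun v => by ring)
      refine (ae_restrict_iff' measurableSet_Ioc).2 (.of_forall fun v hv => ?_)
      have := hM.alloc_mem G v (Ioc_subset_Icc_self hv)
      rw [Real.norm_eq_abs, abs_of_nonneg this.1]; exact this.2
    refine (h2.sub (hf.mul_continuousOn hUac.continuousOn)).congr fun v _ => ?_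
    simp only [mul_sub]
  have heq : ∫ v in (0 : ℝ)..I.H, I.f G v * M.pay G v
      = ∫ v in (0 : ℝ)..I.H, (I.f G v * (v * M.alloc G v - ∫ w in (0 : ℝ)..v, M.alloc G w)
        - I.f G v * U G 0) := by
    refine intervalIntegral.integral_congr fun v hv => ?_
    rw [uIcc_of_le hH] at hv
    rw [hpay v hv]; ring
  rw [heq]
  refine intervalIntegral.integral_mono_on hH (hint.sub (hf.mul_const _)) hint fun v hv => ?_
  have := mul_nonneg (I.f_nonneg G v hv) hUnn
  linarith

theorem IsOptimalPrimal.isOptimalMechanism {a : Item → ℝ → ℝ} (ha : I.IsOptimalPrimal a) :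
    I.IsOptimalMechanism (Mechanism.ofAlloc a) := by
  refine ⟨isTruthful_ofAlloc ha.1, fun M hM => ?_⟩
  obtain ⟨h1, h2⟩ := hM.isFeasible_and_revenue_le
  rw [revenue_ofAlloc ha.1]
  exact h2.trans (ha.2 _ h1)

end AuctionInstance

/-! ### Weak duality and complementary slackness -/

section Utility

variable {a : Item → ℝ → ℝ}

theorem continuous_utility (ha : ∀ G, a G ∈ monotoneUnit) (G : Item) :
    Continuous (utility a G) :=
  intervalIntegral.continuous_primitive (monotoneUnit.intervalIntegrable (ha G)) 0

theorem abs_utility_le (ha : ∀ G, a G ∈ monotoneUnit) (G : Item) (v : ℝ) :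
    |utility a G v| ≤ |v| := by
  have := intervalIntegral.norm_integral_le_of_norm_le_const (a := 0) (b := v) (f := a G) (C := 1)
    fun x _ => monotoneUnit.norm_le (ha G) x
  simpa [utility] using this

end Utility

namespace AuctionInstance

variable (I : AuctionInstance)

/-- The feasible allocation rules that are defined and monotone on all of `ℝ`. -/
def feasibleSet : Set (Item → ℝ → ℝ) :=
  {a | (∀ G, a G ∈ monotoneUnit) ∧ ∀ G, ∀ v ∈ Icc 0 I.H, utility a G v ≤ utility a Item.C v}

variable {I}

theorem isFeasible_of_mem {a : Item → ℝ → ℝ} (ha : a ∈ I.feasibleSet) : I.IsFeasible a :=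
  ⟨fun G v _ => (ha.1 G).2 v, fun G => (ha.1 G).1.monotoneOn _, ha.2 Item.A, ha.2 Item.B⟩

theorem IsFeasible.exists_mem_feasibleSet {a : Item → ℝ → ℝ} (ha : I.IsFeasible a) :
    ∃ a' ∈ I.feasibleSet, I.primalValue a' = I.primalValue a := by
  have hH := I.H_pos.le
  let a' : Item → ℝ → ℝ := fun G v => a G (projIcc 0 I.H hH v)
  have heq : ∀ G, EqOn (a' G) (a G) (Icc 0 I.H) := fun G v hv => by
    simp only [a', projIcc_of_mem hH hv]
  have hu : ∀ G, ∀ v ∈ Icc 0 I.H, utility a' G v = utility a G v := fun G v hv => by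
    refine intervalIntegral.integral_congr fun w hw => ?_
    rw [uIcc_of_le hv.1] at hw
    exact heq G ⟨hw.1, hw.2.trans hv.2⟩
  refine ⟨a', ⟨fun G => ⟨?_, fun v => ?_⟩, fun G v hv => ?_⟩, Item.total_congr fun G => ?_⟩
  · exact fun v w hvw => ha.monotone G (Subtype.prop _) (Subtype.prop _) (monotone_projIcc hH hvw)
  · exact ha.mem G _ (projIcc 0 I.H hH v).2
  · rw [hu G v hv, hu Item.C v hv]
    exact ha.utility_le G hv
  · refine intervalIntegral.integral_congr fun v hv => ?_
    rw [uIcc_of_le hH] at hv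
    simp only [heq G hv]

theorem isOptimalPrimal_of_mem {a : Item → ℝ → ℝ} (ha : a ∈ I.feasibleSet)
    (h : ∀ b ∈ I.feasibleSet, I.primalValue b ≤ I.primalValue a) : I.IsOptimalPrimal a := by
  refine ⟨isFeasible_of_mem ha, fun b hb => ?_⟩
  obtain ⟨b', hb', he⟩ := hb.exists_mem_feasibleSet
  exact he ▸ h b' hb'

end AuctionInstance

namespace DualSolution

variable {I : AuctionInstance} (d : DualSolution I)

/-- The measure `α_{C,G}`, with `α_{C,C} = 0`. -/
def flow (G : Item) : Measure ℝ :=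
  match G with
  | Item.A => d.flowA
  | Item.B => d.flowB
  | Item.C => 0

instance isFiniteMeasure_flow (G : Item) : IsFiniteMeasure (d.flow G) := by
  cases G
  exacts [d.flowA_finite, d.flowB_finite, inferInstanceAs (IsFiniteMeasure (0 : Measure ℝ))]

theorem flow_compl (G : Item) : d.flow G (Icc 0 I.H)ᶜ = 0 := by
  cases G
  exacts [d.flowA_supp, d.flowB_supp, rfl]

theorem antitone_tail (G : Item) : Antitone fun v => (d.flow G).real (Icc v I.H) :=
  fun _ _ h => measureReal_mono (Icc_subset_Icc_left h)

theorem intervalIntegrable_netOutflow (G : Item) (x y : ℝ) :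
    IntervalIntegrable (d.netOutflow G) volume x y := by
  have hA := (d.antitone_tail Item.A).intervalIntegrable (μ := volume) (a := x) (b := y)
  have hB := (d.antitone_tail Item.B).intervalIntegrable (μ := volume) (a := x) (b := y)
  cases G
  exacts [hA.neg, hB.neg, hA.add hB]

theorem intervalIntegrable_deriv_lam (G : Item) :
    IntervalIntegrable (deriv (d.lam G)) volume 0 I.H :=
  (d.lam_ac G).intervalIntegrable_deriv

theorem intervalIntegrable_virtualValue (G : Item) :
    IntervalIntegrable (d.virtualValue G) volume 0 I.H :=
  ((I.intervalIntegrable_myerson G).sub (d.intervalIntegrable_deriv_lam G)).add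
    (d.intervalIntegrable_netOutflow G 0 I.H)

theorem integral_neg_deriv_lam (G : Item) {t : ℝ} (ht : t ∈ Icc 0 I.H) :
    ∫ v in t..I.H, -deriv (d.lam G) v = d.lam G t := by
  have hac : AbsolutelyContinuousOnInterval (d.lam G) t I.H :=
    (d.lam_ac G).mono (uIcc_subset_uIcc_right (by rwa [uIcc_of_le I.H_pos.le]))
  rw [intervalIntegral.integral_neg, hac.integral_deriv_eq_sub, d.lam_H G]
  ring

theorem integrable_utility {a : Item → ℝ → ℝ} (ha : ∀ G, a G ∈ monotoneUnit) (G G' : Item) :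
    Integrable (utility a G) (d.flow G') := by
  refine Integrable.of_bound (continuous_utility ha G).aestronglyMeasurable I.H ?_
  have hae : ∀ᵐ v ∂(d.flow G'), v ∈ Icc 0 I.H := by rw [ae_iff]; exact d.flow_compl G'
  filter_upwards [hae] with v hv
  have := abs_utility_le ha G v
  rw [abs_of_nonneg hv.1] at this
  exact this.trans hv.2

/-- The flow terms of the Lagrangian price the violations of the utility constraints. -/
theorem total_integral_mul_netOutflow {a : Item → ℝ → ℝ} (ha : ∀ G, a G ∈ monotoneUnit) :
    Item.total (fun G => ∫ v in (0 : ℝ)..I.H, a G v * d.netOutflow G v)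
      = Item.total fun G => ∫ v, (utility a Item.C v - utility a G v) ∂(d.flow G) := by
  have hH := I.H_pos.le
  have ht : ∀ G G', ∫ v in (0 : ℝ)..I.H, a G v * (d.flow G').real (Icc v I.H)
      = ∫ v, utility a G v ∂(d.flow G') := fun G G' =>
    integral_mul_tail (ha G) hH (d.flow G') (d.flow_compl G')
  have hi : ∀ G G', IntervalIntegrable (fun v => a G v * (d.flow G').real (Icc v I.H))
      volume 0 I.H := fun G G' =>
    monotoneUnit.intervalIntegrable_mul (ha G) (d.antitone_tail G').intervalIntegrable
  have hs : ∀ G, ∫ v, (utility a Item.C v - utility a G v) ∂(d.flow G)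
      = (∫ v, utility a Item.C v ∂(d.flow G)) - ∫ v, utility a G v ∂(d.flow G) := fun G =>
    integral_sub (d.integrable_utility ha _ _) (d.integrable_utility ha _ _)
  have hA : ∫ v in (0 : ℝ)..I.H, a Item.A v * d.netOutflow Item.A v
      = -∫ v, utility a Item.A v ∂(d.flow Item.A) := by
    rw [← ht, ← intervalIntegral.integral_neg]
    simp only [netOutflow, flow, mul_neg]
  have hB : ∫ v in (0 : ℝ)..I.H, a Item.B v * d.netOutflow Item.B v
      = -∫ v, utility a Item.B v ∂(d.flow Item.B) := by
    rw [← ht, ← intervalIntegral.integral_neg]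
    simp only [netOutflow, flow, mul_neg]
  have hC : ∫ v in (0 : ℝ)..I.H, a Item.C v * d.netOutflow Item.C v
      = (∫ v, utility a Item.C v ∂(d.flow Item.A)) + ∫ v, utility a Item.C v ∂(d.flow Item.B) := by
    rw [← ht, ← ht, ← intervalIntegral.integral_add (hi _ _) (hi _ _)]
    simp only [netOutflow, flow, mul_add]
  simp only [Item.total, hA, hB, hC, hs]
  simp only [flow, integral_zero_measure]
  ring

theorem total_integral_mul_virtualValue {a : Item → ℝ → ℝ} (ha : ∀ G, a G ∈ monotoneUnit) :
    Item.total (fun G => ∫ v in (0 : ℝ)..I.H, a G v * d.virtualValue G v)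
      = I.primalValue a + Item.total (fun G => ∫ v in (0 : ℝ)..I.H, a G v * -deriv (d.lam G) v)
        + Item.total fun G => ∫ v, (utility a Item.C v - utility a G v) ∂(d.flow G) := by
  rw [← d.total_integral_mul_netOutflow ha, AuctionInstance.primalValue, ← Item.total_add,
    ← Item.total_add]
  refine Item.total_congr fun G => ?_
  have h1 := monotoneUnit.intervalIntegrable_mul (ha G) (I.intervalIntegrable_myerson G)
  have h2 : IntervalIntegrable (fun v => a G v * -deriv (d.lam G) v) volume 0 I.H :=
    monotoneUnit.intervalIntegrable_mul (ha G) (d.intervalIntegrable_deriv_lam G).neg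
  have h3 := monotoneUnit.intervalIntegrable_mul (ha G) (d.intervalIntegrable_netOutflow G 0 I.H)
  rw [← intervalIntegral.integral_add h1 h2, ← intervalIntegral.integral_add (h1.add h2) h3]
  refine intervalIntegral.integral_congr fun v _ => ?_
  simp only [virtualValue]
  ring

/-- If a dual is worth no more than a feasible allocation rule, then the three kinds of terms by
which weak duality could be strict all vanish, and this is complementary slackness. -/
theorem complementarySlackness_of_value_le {a : Item → ℝ → ℝ} (ha : a ∈ I.feasibleSet)
    (h : d.value ≤ I.primalValue a) : ComplementarySlackness a d := by
  have hH := I.H_pos.le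
  have hlagr := d.total_integral_mul_virtualValue ha.1
  have hΦ := d.intervalIntegrable_virtualValue
  have haΦ := fun G => monotoneUnit.intervalIntegrable_mul (ha.1 G) (hΦ G)
  have hmax : ∀ G, IntervalIntegrable (fun v => max 0 (d.virtualValue G v)) volume 0 I.H :=
    fun G => by
      have h0 : IntervalIntegrable (fun _ : ℝ => (0 : ℝ)) volume 0 I.H := by simp
      exact ⟨h0.1.sup (hΦ G).1, h0.2.sup (hΦ G).2⟩
  have hpt : ∀ G v, a G v * d.virtualValue G v ≤ max 0 (d.virtualValue G v) := fun G v => by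
    have := (ha.1 G).2 v
    rcases le_total 0 (d.virtualValue G v) with h0 | h0
    · rw [max_eq_right h0]; nlinarith [this.2]
    · rw [max_eq_left h0]; nlinarith [this.1]
  have hlam0 : ∀ G, ∀ t ∈ Icc 0 I.H, 0 ≤ ∫ v in t..I.H, -deriv (d.lam G) v := fun G t ht => by
    rw [d.integral_neg_deriv_lam G ht]; exact d.lam_nonneg G t ht
  have hgap1 : ∀ G, ∫ v in (0 : ℝ)..I.H, a G v * d.virtualValue G v
      ≤ ∫ v in (0 : ℝ)..I.H, max 0 (d.virtualValue G v) := fun G =>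
    intervalIntegral.integral_mono_on hH (haΦ G) (hmax G) fun v _ => hpt G v
  have hgap2 : ∀ G, 0 ≤ ∫ v in (0 : ℝ)..I.H, a G v * -deriv (d.lam G) v := fun G => by
    have := le_integral_mul_of_tail (ha.1 G) hH (d.intervalIntegrable_deriv_lam G).neg (hlam0 G)
      (left_mem_Icc.2 hH) (left_mem_Icc.2 hH) le_rfl (c := 0)
      (fun t ht => hlam0 G t ⟨ht.1, ht.2.trans hH⟩)
    simpa using this
  have hae : ∀ G, ∀ᵐ v ∂(d.flow G), v ∈ Icc 0 I.H := fun G => by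
    rw [ae_iff]; exact d.flow_compl G
  have hflow : ∀ G, 0 ≤ᵐ[d.flow G] fun v => utility a Item.C v - utility a G v := fun G => by
    filter_upwards [hae G] with v hv
    exact sub_nonneg.2 (ha.2 G v hv)
  have hgap3 : ∀ G, 0 ≤ ∫ v, (utility a Item.C v - utility a G v) ∂(d.flow G) := fun G =>
    integral_nonneg_of_ae (hflow G)
  have hzero : ∀ G, (∫ v in (0 : ℝ)..I.H, a G v * d.virtualValue G v
        = ∫ v in (0 : ℝ)..I.H, max 0 (d.virtualValue G v)) ∧
      (∫ v in (0 : ℝ)..I.H, a G v * -deriv (d.lam G) v = 0) ∧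
      ∫ v, (utility a Item.C v - utility a G v) ∂(d.flow G) = 0 := by
    simp only [value, Item.total] at h hlagr
    have a1 := hgap1 Item.A
    have a2 := hgap2 Item.A
    have a3 := hgap3 Item.A
    have b1 := hgap1 Item.B
    have b2 := hgap2 Item.B
    have b3 := hgap3 Item.B
    have c1 := hgap1 Item.C
    have c2 := hgap2 Item.C
    have c3 := hgap3 Item.C
    rintro (_ | _ | _) <;> refine ⟨?_, ?_, ?_⟩ <;> linarith
  have hpos : ∀ G, ∀ᵐ v : ℝ, v ∈ Icc 0 I.H →
      a G v * d.virtualValue G v = max 0 (d.virtualValue G v) := fun G => by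
    have hsub : ∫ v in (0 : ℝ)..I.H,
        (max 0 (d.virtualValue G v) - a G v * d.virtualValue G v) = 0 := by
      rw [intervalIntegral.integral_sub (hmax G) (haΦ G), (hzero G).1, sub_self]
    rw [intervalIntegral.integral_eq_zero_iff_of_le_of_nonneg_ae hH
      (.of_forall fun v => sub_nonneg.2 (hpt G v)) ((hmax G).sub (haΦ G))] at hsub
    have hsub := (ae_restrict_iff' measurableSet_Ioc).1 hsub
    have hn : ∀ᵐ v : ℝ, v ≠ 0 := by simp [ae_iff]
    filter_upwards [hsub, hn] with v hv hv0 hvI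
    have := hv ⟨lt_of_le_of_ne hvI.1 hv0.symm, hvI.2⟩
    simp only [Pi.zero_apply] at this
    linarith
  have hflow0 : ∀ G, ∀ᵐ v ∂(d.flow G), utility a Item.C v = utility a G v := fun G => by
    have := (integral_eq_zero_iff_of_nonneg_ae (hflow G)
      ((d.integrable_utility ha.1 _ _).sub (d.integrable_utility ha.1 _ _))).1 (hzero G).2.2
    filter_upwards [this] with v hv
    exact sub_eq_zero.1 hv
  refine ⟨fun G => ?_, fun G => ?_, fun G v hv hl => ?_, hflow0 Item.A, hflow0 Item.B⟩
  · filter_upwards [hpos G] with v hv hvI hΦv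
    have := hv hvI
    rw [max_eq_right hΦv.le] at this
    exact mul_right_cancel₀ hΦv.ne' (this.trans (one_mul _).symm)
  · filter_upwards [hpos G] with v hv hvI hΦv
    have := hv hvI
    rw [max_eq_left hΦv.le] at this
    exact (mul_eq_zero.1 this).resolve_right hΦv.ne
  · -- `a G` is constant on a neighbourhood of `v` on which `lam G` is bounded away from `0`.
    have hcont : ContinuousOn (d.lam G) (Icc 0 I.H) := by
      have := (d.lam_ac G).continuousOn
      rwa [uIcc_of_le hH] at this
    have hev : ∀ᶠ w in 𝓝[Icc 0 I.H] v, d.lam G v / 2 < d.lam G w :=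
      (hcont v hv).eventually (lt_mem_nhds (half_lt_self hl))
    rw [eventually_nhdsWithin_iff, Metric.eventually_nhds_iff] at hev
    obtain ⟨ε, hε, hev⟩ := hev
    have hconst : ∀ x ∈ Icc 0 I.H, ∀ y ∈ Icc 0 I.H, dist x v < ε → dist y v < ε → x ≤ y →
        a G x = a G y := by
      intro x hx y hy hxv hyv hxy
      refine le_antisymm ((ha.1 G).1 hxy) ?_
      have := le_integral_mul_of_tail (ha.1 G) hH (d.intervalIntegrable_deriv_lam G).neg (hlam0 G)
        hx hy hxy (c := d.lam G v / 2) (fun t ht => by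
          have htI : t ∈ Icc 0 I.H := ⟨hx.1.trans ht.1, ht.2.trans hy.2⟩
          have h1 := d.integral_neg_deriv_lam G htI
          simp only [Pi.neg_apply]
          rw [h1]
          refine (hev ?_ htI).le
          rw [Real.dist_eq, abs_lt] at hxv hyv ⊢
          exact ⟨by linarith [ht.1], by linarith [ht.2]⟩)
      have h2 := (hzero G).2.1
      simp only [Pi.neg_apply] at this
      rw [h2] at this
      nlinarith
    refine (hasDerivWithinAt_const v _ (a G v)).congr_of_eventuallyEq ?_ rfl
    filter_upwards [self_mem_nhdsWithin, mem_nhdsWithin_of_mem_nhds (Metric.ball_mem_nhds v hε)]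
      with w hw hwv
    rcases le_total w v with hle | hle
    · exact hconst w hw v hv hwv (by simpa using hε) hle
    · exact (hconst v hv w hw (by simpa using hε) hwv hle).symm

end DualSolution

/-! ### Strong duality -/

section Ironing

theorem AbsolutelyContinuousOnInterval.of_dist_le {k W : ℝ → ℝ} {x y : ℝ}
    (hW : AbsolutelyContinuousOnInterval W x y)
    (h : ∀ s ∈ uIcc x y, ∀ t ∈ uIcc x y, dist (k s) (k t) ≤ dist (W s) (W t)) :
    AbsolutelyContinuousOnInterval k x y := by
  rw [absolutelyContinuousOnInterval_iff] at hW ⊢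
  intro ε hε
  obtain ⟨δ, hδ, hW⟩ := hW ε hε
  refine ⟨δ, hδ, fun E hE hlt => lt_of_le_of_lt (Finset.sum_le_sum fun i hi => ?_) (hW E hE hlt)⟩
  exact h _ (hE.1 i hi).1 _ (hE.1 i hi).2

/-- Ironing. Let `h t = ∫ v in t..L, g v` and let `k` be its running maximum from the right, the
least non-increasing function above `h`. The multiplier `k - h` turns the virtual value `g` into
`-k' ≥ 0`, whose integral `k 0` is the maximum of `h`. -/
theorem exists_ironing {g : ℝ → ℝ} {L : ℝ} (hL : 0 ≤ L) (hg : IntervalIntegrable g volume 0 L) :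
    ∃ lam : ℝ → ℝ, (∀ v ∈ Icc 0 L, 0 ≤ lam v) ∧ AbsolutelyContinuousOnInterval lam 0 L ∧
      lam L = 0 ∧ ∃ t ∈ Icc 0 L,
        ∫ v in (0 : ℝ)..L, max 0 (g v - deriv lam v) = ∫ v in t..L, g v := by
  have hsub : ∀ {s t}, s ∈ Icc 0 L → t ∈ Icc 0 L → IntervalIntegrable g volume s t :=
    fun hs ht => hg.mono_set (by rw [uIcc_of_le hL]; exact uIcc_subset_Icc hs ht)
  have h0m : (0 : ℝ) ∈ Icc 0 L := left_mem_Icc.2 hL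
  have hLm : L ∈ Icc 0 L := right_mem_Icc.2 hL
  set h : ℝ → ℝ := fun t => ∫ v in t..L, g v with hh
  have hhL : h L = 0 := by simp [hh]
  have hac : AbsolutelyContinuousOnInterval h 0 L := by
    have := (hg.absolutelyContinuousOnInterval_intervalIntegral (c := L) right_mem_uIcc).neg
    refine this.of_dist_le fun s _ t _ => ?_
    simp only [hh, Pi.neg_apply, intervalIntegral.integral_symm s L,
      intervalIntegral.integral_symm t L]
    simp
  have hcont : ContinuousOn h (Icc 0 L) := by
    have := hac.continuousOn
    rwa [uIcc_of_le hL] at this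
  set k : ℝ → ℝ := fun t => sSup (h '' Icc t L) with hk
  have hbdd : ∀ t ∈ Icc 0 L, BddAbove (h '' Icc t L) := fun t ht =>
    (isCompact_Icc.image_of_continuousOn (hcont.mono (Icc_subset_Icc_left ht.1))).bddAbove
  have hle : ∀ t ∈ Icc 0 L, ∀ w ∈ Icc t L, h w ≤ k t := fun t ht w hw =>
    le_csSup (hbdd t ht) (mem_image_of_mem h hw)
  have hkle : ∀ t ∈ Icc 0 L, ∀ c, (∀ w ∈ Icc t L, h w ≤ c) → k t ≤ c := fun t ht c hc =>
    csSup_le ((nonempty_Icc.2 ht.2).image h) (by rintro _ ⟨w, hw, rfl⟩; exact hc w hw)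
  have hanti : AntitoneOn k (Icc 0 L) := fun s hs t ht hst =>
    hkle t ht _ fun w hw => hle s hs w ⟨hst.trans hw.1, hw.2⟩
  have hkL : k L = 0 := by simp [hk, hhL]
  have hW := hg.abs.absolutelyContinuousOnInterval_intervalIntegral (c := 0) left_mem_uIcc
  have hWk : ∀ s ∈ Icc 0 L, ∀ t ∈ Icc 0 L, s ≤ t →
      k s ≤ k t + ((∫ v in (0 : ℝ)..t, |g v|) - ∫ v in (0 : ℝ)..s, |g v|) := by
    intro s hs t ht hst
    rw [intervalIntegral.integral_interval_sub_left (hsub h0m ht).abs (hsub h0m hs).abs]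
    refine hkle s hs _ fun w hw => ?_
    have hwI : w ∈ Icc 0 L := ⟨hs.1.trans hw.1, hw.2⟩
    have hnn : 0 ≤ ∫ v in s..t, |g v| :=
      intervalIntegral.integral_nonneg hst fun v _ => abs_nonneg _
    rcases le_total t w with htw | hwt
    · linarith [hle t ht w ⟨htw, hw.2⟩]
    · have h1 : h w = h t + ∫ v in w..t, g v := by
        simp only [hh]
        rw [add_comm, intervalIntegral.integral_add_adjacent_intervals (hsub hwI ht) (hsub ht hLm)]
      have h2 : ∫ v in w..t, g v ≤ ∫ v in w..t, |g v| :=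
        intervalIntegral.integral_mono_on hwt (hsub hwI ht) (hsub hwI ht).abs
          fun v _ => le_abs_self _
      have h3 : ∫ v in w..t, |g v| ≤ ∫ v in s..t, |g v| :=
        intervalIntegral.integral_mono_interval hw.1 hwt le_rfl (.of_forall fun v => abs_nonneg _)
          (hsub hs ht).abs
      linarith [hle t ht t ⟨le_rfl, ht.2⟩]
  have hkac : AbsolutelyContinuousOnInterval k 0 L := by
    refine hW.of_dist_le ?_
    rw [uIcc_of_le hL]
    have key : ∀ s ∈ Icc 0 L, ∀ t ∈ Icc 0 L, s ≤ t → dist (k s) (k t)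
        ≤ dist (∫ v in (0 : ℝ)..s, |g v|) (∫ v in (0 : ℝ)..t, |g v|) := by
      intro s hs t ht hst
      rw [Real.dist_eq, abs_of_nonneg (sub_nonneg.2 (hanti hs ht hst)), dist_comm, Real.dist_eq]
      have := hWk s hs t ht hst
      exact le_trans (by linarith) (le_abs_self _)
    intro s hs t ht
    rcases le_total s t with hst | hst
    · exact key s hs t ht hst
    · rw [dist_comm, dist_comm (∫ v in (0 : ℝ)..s, |g v|)]
      exact key t ht s hs hst
  obtain ⟨t, ht, htmax⟩ := isCompact_Icc.exists_isMaxOn ⟨0, h0m⟩ hcont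
  have hk0 : k 0 = h t := le_antisymm (hkle 0 h0m _ fun w hw => htmax hw) (hle 0 h0m t ht)
  refine ⟨fun v => k v - h v, fun v hv => sub_nonneg.2 (hle v hv v ⟨le_rfl, hv.2⟩),
    hkac.sub hac, by simp [hkL, hhL], t, ht, ?_⟩
  have hderiv : ∫ v in (0 : ℝ)..L, max 0 (g v - deriv (fun v => k v - h v) v)
      = ∫ v in (0 : ℝ)..L, -deriv k v := by
    refine intervalIntegral.integral_congr_ae ?_
    have hn : ∀ᵐ v : ℝ, v ≠ L := by simp [ae_iff]
    filter_upwards [hkac.ae_differentiableAt, hg.ae_hasDerivAt_integral, hn] with v h1 h2 h3 hv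
    have hvI := uIoc_subset_uIcc hv
    have hd : HasDerivAt h (-g v) v := by
      have := (h2 hvI L right_mem_uIcc).neg
      refine this.congr_of_eventuallyEq (.of_forall fun x => ?_)
      exact intervalIntegral.integral_symm L x
    have hkd := (h1 hvI).hasDerivAt
    have hnonpos : deriv k v ≤ 0 := by
      rw [uIoc_of_le hL] at hv
      have hnhds : Icc 0 L ∈ 𝓝 v := Icc_mem_nhds hv.1 (lt_of_le_of_ne hv.2 h3)
      rw [← derivWithin_of_mem_nhds hnhds]
      exact hanti.derivWithin_nonpos
    have : deriv (fun v => k v - h v) v = deriv k v + g v := by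
      rw [(hkd.fun_sub hd).deriv]; ring
    rw [this, max_eq_right] <;> linarith
  rw [hderiv, intervalIntegral.integral_neg, hkac.integral_deriv_eq_sub, hkL, hk0]
  simp [hh]

end Ironing

theorem step_mem_monotoneUnit (t : ℝ) : (Ici t).indicator (fun _ => (1 : ℝ)) ∈ monotoneUnit := by
  refine ⟨fun v w hvw => ?_, fun v => ?_⟩
  · by_cases h : t ≤ v
    · simp [h, h.trans hvw]
    · rw [indicator_of_notMem (by simpa using h)]
      exact indicator_nonneg (by simp) _
  · by_cases h : t ≤ v <;> simp [h, indicator]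

theorem integral_step_mul {g : ℝ → ℝ} {L t : ℝ} (ht : t ∈ Icc 0 L) :
    ∫ v in (0 : ℝ)..L, (Ici t).indicator (fun _ => (1 : ℝ)) v * g v = ∫ v in t..L, g v := by
  have h1 : (fun v => (Ici t).indicator (fun _ => (1 : ℝ)) v * g v) = (Ici t).indicator g := by
    ext v; by_cases h : t ≤ v <;> simp [h, indicator]
  rw [h1, intervalIntegral.integral_of_le (ht.1.trans ht.2), setIntegral_indicator measurableSet_Ici,
    intervalIntegral.integral_of_le ht.2]
  refine setIntegral_congr_set ?_
  have hn : ∀ᵐ w : ℝ, w ≠ t := by simp [ae_iff]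
  filter_upwards [hn] with w hw
  exact propext ⟨fun h => ⟨lt_of_le_of_ne h.2 hw.symm, h.1.2⟩,
    fun h => ⟨⟨ht.1.trans_lt h.1, h.2⟩, h.1.le⟩⟩

/-- The allocation rules that are monotone with values in `[0, 1]`; the utility constraints are
dropped. -/
def monotoneAllocations : Set (Item → ℝ → ℝ) := {a | ∀ G, a G ∈ monotoneUnit}

theorem isCompact_monotoneAllocations : IsCompact monotoneAllocations := by
  have := isCompact_univ_pi fun _ : Item => isCompact_monotoneUnit
  convert this using 1
  ext a; simp [monotoneAllocations, Set.mem_pi]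

theorem convex_monotoneAllocations : Convex ℝ monotoneAllocations := by
  intro a ha b hb s t hs ht hst G
  refine ⟨fun v w hvw => ?_, fun v => ?_⟩
  · have h1 := mul_le_mul_of_nonneg_left ((ha G).1 hvw) hs
    have h2 := mul_le_mul_of_nonneg_left ((hb G).1 hvw) ht
    simpa using add_le_add h1 h2
  · exact (convex_Icc (0 : ℝ) 1) ((ha G).2 v) ((hb G).2 v) hs ht hst

theorem mapsTo_eval (G : Item) : MapsTo (fun a : Item → ℝ → ℝ => a G) monotoneAllocations
    monotoneUnit := fun _ ha => ha G

theorem continuousOn_utility (G : Item) {v : ℝ} (hv : 0 ≤ v) :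
    ContinuousOn (fun a : Item → ℝ → ℝ => utility a G v) monotoneAllocations :=
  (continuousOn_integral hv).comp (continuous_apply G).continuousOn (mapsTo_eval G)

theorem utility_combo {a b : Item → ℝ → ℝ} (ha : a ∈ monotoneAllocations)
    (hb : b ∈ monotoneAllocations) (s t : ℝ) (G : Item) (v : ℝ) :
    utility (s • a + t • b) G v = s * utility a G v + t * utility b G v := by
  simp only [utility, ← intervalIntegral.integral_const_mul]
  rw [← intervalIntegral.integral_add ((monotoneUnit.intervalIntegrable (ha G) _ _).const_mul _)
    ((monotoneUnit.intervalIntegrable (hb G) _ _).const_mul _)]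
  rfl

namespace AuctionInstance

variable (I : AuctionInstance)

theorem continuousOn_primalValue : ContinuousOn I.primalValue monotoneAllocations := by
  have h : ∀ G, ContinuousOn (fun a : Item → ℝ → ℝ => ∫ v in (0 : ℝ)..I.H, a G v * I.myerson G v)
      monotoneAllocations := fun G =>
    (continuousOn_integral_mul I.H_pos.le (I.intervalIntegrable_myerson G)).comp
      (continuous_apply G).continuousOn (mapsTo_eval G)
  exact ((h Item.A).add (h Item.B)).add (h Item.C)

theorem primalValue_combo {a b : Item → ℝ → ℝ} (ha : a ∈ monotoneAllocations)
    (hb : b ∈ monotoneAllocations) (s t : ℝ) :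
    I.primalValue (s • a + t • b) = s * I.primalValue a + t * I.primalValue b := by
  rw [primalValue, primalValue, primalValue, ← Item.total_mul_left, ← Item.total_mul_left,
    ← Item.total_add]
  refine Item.total_congr fun G => ?_
  have h1 := monotoneUnit.intervalIntegrable_mul (ha G) (I.intervalIntegrable_myerson G)
  have h2 := monotoneUnit.intervalIntegrable_mul (hb G) (I.intervalIntegrable_myerson G)
  rw [← intervalIntegral.integral_const_mul, ← intervalIntegral.integral_const_mul,
    ← intervalIntegral.integral_add (h1.const_mul _) (h2.const_mul _)]
  refine intervalIntegral.integral_congr fun v _ => ?_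
  simp only [Pi.add_apply, Pi.smul_apply, smul_eq_mul]
  ring

theorem zero_mem_feasibleSet : (0 : Item → ℝ → ℝ) ∈ I.feasibleSet := by
  refine ⟨fun G => ⟨fun v w _ => le_rfl, fun v => by simp⟩, fun G v _ => by simp [utility]⟩

theorem isClosed_setOf_utility_le (G : Item) {v : ℝ} (hv : 0 ≤ v) :
    IsClosed {a | a ∈ monotoneAllocations ∧ utility a G v ≤ utility a Item.C v} := by
  have h := (continuousOn_utility Item.C hv).sub (continuousOn_utility G hv)
  have := h.preimage_isClosed_of_isClosed isCompact_monotoneAllocations.isClosed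
    (isClosed_Ici (a := (0 : ℝ)))
  convert this using 1
  ext a; simp

theorem isClosed_setOf_le_primalValue (c : ℝ) :
    IsClosed {a | a ∈ monotoneAllocations ∧ c ≤ I.primalValue a} :=
  I.continuousOn_primalValue.preimage_isClosed_of_isClosed
    isCompact_monotoneAllocations.isClosed (isClosed_Ici (a := c))

theorem isCompact_feasibleSet : IsCompact I.feasibleSet := by
  refine isCompact_monotoneAllocations.of_isClosed_subset ?_ fun a ha => ha.1
  have : I.feasibleSet = monotoneAllocations ∩ ⋂ (G : Item) (v : Icc 0 I.H),
      {a | a ∈ monotoneAllocations ∧ utility a G v ≤ utility a Item.C v} := by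
    ext a
    simp only [feasibleSet, monotoneAllocations, mem_inter_iff, mem_iInter, mem_ofPred_eq,
      Subtype.forall]
    exact ⟨fun h => ⟨h.1, fun G v hv => ⟨h.1, h.2 G v hv⟩⟩,
      fun h => ⟨h.1, fun G v hv => (h.2 G v hv).2⟩⟩
  rw [this]
  exact isCompact_monotoneAllocations.isClosed.inter
    (isClosed_iInter fun G => isClosed_iInter fun v => isClosed_setOf_utility_le G v.2.1)

/-- By compactness, finitely many of the utility constraints bound the primal value up to `ε`. -/
theorem exists_finset_constraints {c ε : ℝ} (hc : ∀ a ∈ I.feasibleSet, I.primalValue a ≤ c)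
    (hε : 0 < ε) : ∃ T : Finset (Item × Icc 0 I.H), ∀ a ∈ monotoneAllocations,
      (∀ j ∈ T, utility a j.1 j.2 ≤ utility a Item.C j.2) → I.primalValue a < c + ε := by
  have hS : IsCompact {a | a ∈ monotoneAllocations ∧ c + ε ≤ I.primalValue a} :=
    isCompact_monotoneAllocations.of_isClosed_subset (I.isClosed_setOf_le_primalValue _)
      fun a ha => ha.1
  obtain ⟨T, hT⟩ := hS.elim_finite_subfamily_closed
    (fun j : Item × Icc 0 I.H =>
      {a | a ∈ monotoneAllocations ∧ utility a j.1 j.2 ≤ utility a Item.C j.2})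
    (fun j => isClosed_setOf_utility_le j.1 j.2.2.1) (by
      rw [eq_empty_iff_forall_notMem]
      rintro a ⟨ha, hu⟩
      rw [mem_iInter] at hu
      have := hc a ⟨ha.1, fun G v hv => (hu (G, ⟨v, hv⟩)).2⟩
      linarith [ha.2])
  refine ⟨T, fun a ha hu => ?_⟩
  by_contra hlt
  have : a ∈ ({a | a ∈ monotoneAllocations ∧ c + ε ≤ I.primalValue a} ∩ ⋂ i ∈ T,
      {a | a ∈ monotoneAllocations ∧ utility a i.1 i.2 ≤ utility a Item.C i.2}) :=
    ⟨⟨ha, not_lt.1 hlt⟩, mem_iInter₂.2 fun j hj => ⟨ha, hu j hj⟩⟩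
  rw [hT] at this
  exact this

/-- Finite-dimensional Lagrange multipliers for the constraints in `T`. -/
theorem exists_multipliers {c : ℝ} (T : Finset (Item × Icc 0 I.H))
    (hT : ∀ a ∈ monotoneAllocations,
      (∀ j ∈ T, utility a j.1 j.2 ≤ utility a Item.C j.2) → I.primalValue a < c) :
    ∃ θ : T → ℝ, (∀ j, 0 ≤ θ j) ∧ ∀ a ∈ monotoneAllocations, I.primalValue a +
      ∑ j : T, θ j * (utility a Item.C j.1.2 - utility a j.1.1 j.1.2) ≤ c := by
  let Ψ : (Item → ℝ → ℝ) → ℝ × (T → ℝ) := fun a =>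
    (I.primalValue a - c, fun j => utility a Item.C j.1.2 - utility a j.1.1 j.1.2)
  have hcont : ContinuousOn Ψ monotoneAllocations :=
    (I.continuousOn_primalValue.sub continuousOn_const).prodMk (continuousOn_pi.2 fun j =>
      (continuousOn_utility _ j.1.2.2.1).sub (continuousOn_utility _ j.1.2.2.1))
  have hconv : Convex ℝ (Ψ '' monotoneAllocations) := by
    rintro _ ⟨a, ha, rfl⟩ _ ⟨b, hb, rfl⟩ s t hs ht hst
    refine ⟨s • a + t • b, convex_monotoneAllocations ha hb hs ht hst, ?_⟩
    refine Prod.ext ?_ (funext fun j => ?_)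
    · simp only [Ψ, Prod.fst_add, Prod.smul_fst, smul_eq_mul, I.primalValue_combo ha hb]
      linear_combination c * hst
    · simp only [Ψ, Prod.snd_add, Prod.smul_snd, Pi.add_apply, Pi.smul_apply, smul_eq_mul,
        utility_combo ha hb]
      ring
  have hdisj : Disjoint (Ψ '' monotoneAllocations) (Ici (0 : ℝ × (T → ℝ))) := by
    rw [Set.disjoint_left]
    rintro _ ⟨a, ha, rfl⟩ h
    have h1 : 0 ≤ I.primalValue a - c := h.1
    have h2 := hT a ha fun j hj => sub_nonneg.1 (h.2 ⟨j, hj⟩)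
    linarith
  obtain ⟨f, u, w, hfu, huw, hfw⟩ := geometric_hahn_banach_compact_closed hconv
    (isCompact_monotoneAllocations.image_of_continuousOn hcont) (convex_Ici _) isClosed_Ici hdisj
  have hw0 : w < 0 := by simpa using hfw 0 self_mem_Ici
  have hfnn : ∀ b : ℝ × (T → ℝ), 0 ≤ b → 0 ≤ f b := by
    intro b hb
    by_contra hneg
    push Not at hneg
    have h1 := hfw ((w / f b) • b) (smul_nonneg (div_nonneg_of_nonpos hw0.le hneg.le) hb)
    rw [map_smul, smul_eq_mul, div_mul_cancel₀ _ hneg.ne] at h1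
    exact lt_irrefl _ h1
  have hneg : ∀ a ∈ monotoneAllocations, f (Ψ a) < 0 := fun a ha =>
    (hfu _ (mem_image_of_mem Ψ ha)).trans (huw.trans hw0)
  set θ₀ : ℝ := f (1, 0) with hθ₀
  set θ : T → ℝ := fun j => f (0, Pi.single j 1) with hθ
  have hf : ∀ x y, f (x, y) = θ₀ * x + ∑ j, θ j * y j := by
    intro x y
    have h1 : (x, y) = x • ((1 : ℝ), (0 : T → ℝ)) + ∑ j, y j • ((0 : ℝ), Pi.single j (1 : ℝ)) := by
      refine Prod.ext ?_ ?_
      · simp [Prod.fst_sum]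
      · ext i
        simp [Prod.snd_sum, Finset.sum_apply, Pi.single_apply]
    rw [h1, map_add, map_sum, map_smul]
    simp only [map_smul, smul_eq_mul, ← hθ₀, hθ, mul_comm]
  have hθnn : ∀ j, 0 ≤ θ j := fun j =>
    hfnn _ ⟨le_rfl, fun i => by
      by_cases h : i = j
      · subst h; simp
      · simp [h]⟩
  have hθ₀nn : 0 ≤ θ₀ := hfnn _ ⟨zero_le_one, le_rfl⟩
  -- The zero allocation satisfies all constraints, so the objective cannot have weight zero.
  have hθ₀pos : 0 < θ₀ := by
    refine lt_of_le_of_ne hθ₀nn fun h0 => ?_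
    have h1 := hneg 0 I.zero_mem_feasibleSet.1
    rw [hf, ← h0] at h1
    simp [utility] at h1
  refine ⟨fun j => θ j / θ₀, fun j => div_nonneg (hθnn j) hθ₀pos.le, fun a ha => ?_⟩
  have h1 := hneg a ha
  rw [hf] at h1
  have h2 : ∑ j : T, θ j / θ₀ * (utility a Item.C j.1.2 - utility a j.1.1 j.1.2)
      = (∑ j : T, θ j * (utility a Item.C j.1.2 - utility a j.1.1 j.1.2)) / θ₀ := by
    rw [Finset.sum_div]
    exact Finset.sum_congr rfl fun j _ => by ring
  rw [h2]
  have h3 : (∑ j : T, θ j * (utility a Item.C j.1.2 - utility a j.1.1 j.1.2)) / θ₀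
      < c - I.primalValue a := by
    rw [div_lt_iff₀ hθ₀pos]; linarith
  linarith

variable {I}

/-- A bound on the Lagrangian relaxation of the utility constraints is attained, by ironing, by a
dual solution with the same flow. -/
theorem exists_dual_of_unironed (d : DualSolution I) (hlam : d.lam = 0) {c : ℝ}
    (hc : ∀ a ∈ monotoneAllocations,
      Item.total (fun G => ∫ v in (0 : ℝ)..I.H, a G v * d.virtualValue G v) ≤ c) :
    ∃ d' : DualSolution I, d'.value ≤ c := by
  choose lam h0 hac hH t ht hval using fun G =>
    exists_ironing I.H_pos.le (d.intervalIntegrable_virtualValue G)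
  refine ⟨⟨lam, h0, hac, hH, d.flowA, d.flowB, d.flowA_finite, d.flowB_finite, d.flowA_supp,
    d.flowB_supp⟩, ?_⟩
  have hstep := hc (fun G => (Ici (t G)).indicator fun _ => 1) fun G => step_mem_monotoneUnit _
  refine le_trans (le_of_eq (Item.total_congr fun G => ?_)) hstep
  rw [integral_step_mul (ht G), ← hval G]
  refine intervalIntegral.integral_congr fun v _ => ?_
  have hd : deriv (d.lam G) v = 0 := by
    rw [hlam]; exact deriv_const v (0 : ℝ)
  have e : ∀ x y z w : ℝ, w = 0 → max 0 (x - y + z) = max 0 (x - w + z - y) := by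
    rintro x y z w rfl; congr 1; ring
  cases G <;> exact e _ _ _ _ hd

/-- Strong duality: the dual value comes arbitrarily close to any bound on the primal value. -/
theorem exists_dual_value_le {c ε : ℝ} (hc : ∀ a ∈ I.feasibleSet, I.primalValue a ≤ c)
    (hε : 0 < ε) : ∃ d : DualSolution I, d.value ≤ c + ε := by
  obtain ⟨T, hT⟩ := I.exists_finset_constraints hc hε
  obtain ⟨θ, hθ, hθle⟩ := I.exists_multipliers T hT
  let α : Item → Measure ℝ := fun G =>
    ∑ j : T, ENNReal.ofReal (if j.1.1 = G then θ j else 0) • Measure.dirac (j.1.2 : ℝ)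
  have hfin : ∀ G, IsFiniteMeasure (α G) := fun G => by
    refine ⟨?_⟩
    simp only [α, Measure.coe_finsetSum, Finset.sum_apply, Measure.smul_apply, smul_eq_mul,
      measure_univ, mul_one]
    exact ENNReal.sum_lt_top.2 fun j _ => ENNReal.ofReal_lt_top
  have hsupp : ∀ G, α G (Icc 0 I.H)ᶜ = 0 := fun G => by
    simp only [α, Measure.coe_finsetSum, Finset.sum_apply, Measure.smul_apply, smul_eq_mul]
    refine Finset.sum_eq_zero fun j _ => ?_
    rw [Measure.dirac_apply' _ measurableSet_Icc.compl,
      indicator_of_notMem (notMem_compl_iff.2 j.1.2.2), mul_zero]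
  let d : DualSolution I :=
    { lam := 0
      lam_nonneg := fun _ _ _ => le_rfl
      lam_ac := fun _ => (contDiffOn_const (c := (0 : ℝ))).absolutelyContinuousOnInterval
      lam_H := fun _ => rfl
      flowA := α Item.A
      flowB := α Item.B
      flowA_finite := hfin _
      flowB_finite := hfin _
      flowA_supp := hsupp _
      flowB_supp := hsupp _ }
  refine exists_dual_of_unironed d rfl fun a ha => ?_
  refine le_trans (le_of_eq ?_) (hθle a ha)
  rw [d.total_integral_mul_virtualValue ha]
  have hlam : Item.total (fun G => ∫ v in (0 : ℝ)..I.H, a G v * -deriv (d.lam G) v) = 0 := by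
    have : ∀ G v, deriv (d.lam G) v = 0 := fun G v => deriv_const v (0 : ℝ)
    simp [this, Item.total]
  rw [hlam, add_zero]
  congr 1
  have hint : ∀ G, ∫ v, (utility a Item.C v - utility a G v) ∂(α G)
      = ∑ j : T, (if j.1.1 = G then θ j else 0) *
        (utility a Item.C j.1.2 - utility a G j.1.2) := fun G => by
    simp only [α]
    rw [integral_finsetSum_measure]
    · refine Finset.sum_congr rfl fun j _ => ?_
      rw [integral_smul_measure, integral_dirac, ENNReal.toReal_ofReal, smul_eq_mul]
      split_ifs
      exacts [hθ j, le_rfl]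
    · intro j _
      exact (integrable_dirac (by simp)).smul_measure ENNReal.ofReal_ne_top
  simp only [Item.total]
  have hA := hint Item.A
  have hB := hint Item.B
  change (∫ v, (utility a Item.C v - utility a Item.A v) ∂(α Item.A)) +
    (∫ v, (utility a Item.C v - utility a Item.B v) ∂(α Item.B)) +
    (∫ v, (utility a Item.C v - utility a Item.C v) ∂(0 : Measure ℝ)) = _
  rw [hA, hB, integral_zero_measure, add_zero, ← Finset.sum_add_distrib]
  refine Finset.sum_congr rfl fun j _ => ?_
  rcases hj : j.1.1 with _ | _ | _ <;> simp

end AuctionInstance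

/-! ### Vertices of the feasible set and their perturbations -/

section Truncation

/-- The part of `x` that lies in `[l, r]`, measured from `l`. -/
def truncation (l r x : ℝ) : ℝ := max l (min x r) - l

variable {l r x y : ℝ}

theorem truncation_of_le (h : x ≤ l) (hlr : l ≤ r) : truncation l r x = 0 := by
  rw [truncation, min_eq_left (h.trans hlr), max_eq_left h, sub_self]

theorem truncation_of_ge (h : r ≤ x) (hlr : l ≤ r) : truncation l r x = r - l := by
  rw [truncation, min_eq_right h, max_eq_right hlr]

theorem truncation_of_mem (h : x ∈ Icc l r) : truncation l r x = x - l := by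
  rw [truncation, min_eq_left h.2, max_eq_right h.1]

theorem monotone_truncation (l r : ℝ) : Monotone (truncation l r) := fun _ _ h =>
  sub_le_sub_right (max_le_max_left _ (min_le_min_right _ h)) _

theorem truncation_sub_le (h : x ≤ y) : truncation l r y - truncation l r x ≤ y - x := by
  simp only [truncation]
  rcases max_cases l (min y r) with h1 | h1 <;> rcases max_cases l (min x r) with h2 | h2 <;>
    rcases min_cases y r with h3 | h3 <;> rcases min_cases x r with h4 | h4 <;> linarith

theorem abs_truncation_sub_le (l r x y : ℝ) :
    |truncation l r x - truncation l r y| ≤ |x - y| := by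
  wlog h : y ≤ x generalizing x y
  · rw [abs_sub_comm, abs_sub_comm x]; exact this y x (le_of_not_ge h)
  · rw [abs_of_nonneg (sub_nonneg.2 (monotone_truncation l r h)), abs_of_nonneg (sub_nonneg.2 h)]
    exact truncation_sub_le h

end Truncation

/-- Three unknown slopes, two linear equations: on three consecutive intervals of values there is a
small nonzero piecewise linear `ψ` that vanishes off them and has `∫ ψ ∘ b = 0`. -/
theorem exists_perturbation {κ₀ κ₁ κ₂ κ₃ : ℝ} (h1 : κ₀ < κ₁) (h2 : κ₁ < κ₂) (h3 : κ₂ < κ₃)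
    {b : ℝ → ℝ} (hb : Monotone b) (x y : ℝ) {ε : ℝ} (hε : 0 < ε) :
    ∃ (ψ : ℝ → ℝ) (s₁ s₂ s₃ : ℝ), (∀ s t, |ψ s - ψ t| ≤ ε * |s - t|) ∧
      (∀ s ≤ κ₀, ψ s = 0) ∧ (∀ s, κ₃ ≤ s → ψ s = 0) ∧ (ψ κ₁ ≠ 0 ∨ ψ κ₂ ≠ 0) ∧
      (|s₁| ≤ ε ∧ |s₂| ≤ ε ∧ |s₃| ≤ ε) ∧
      (∀ s ∈ Icc κ₀ κ₁, ∀ t ∈ Icc κ₀ κ₁, ψ s - ψ t = s₁ * (s - t)) ∧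
      (∀ s ∈ Icc κ₁ κ₂, ∀ t ∈ Icc κ₁ κ₂, ψ s - ψ t = s₂ * (s - t)) ∧
      (∀ s ∈ Icc κ₂ κ₃, ∀ t ∈ Icc κ₂ κ₃, ψ s - ψ t = s₃ * (s - t)) ∧
      ∫ v in x..y, ψ (b v) = 0 := by
  set J : ℝ → ℝ → ℝ := fun l r => ∫ v in x..y, truncation l r (b v) with hJ
  obtain ⟨s₁, s₂, s₃, hne, hd, hint⟩ : ∃ s₁ s₂ s₃ : ℝ, ¬(s₁ = 0 ∧ s₂ = 0 ∧ s₃ = 0) ∧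
      s₁ * (κ₁ - κ₀) + s₂ * (κ₂ - κ₁) + s₃ * (κ₃ - κ₂) = 0 ∧
      s₁ * J κ₀ κ₁ + s₂ * J κ₁ κ₂ + s₃ * J κ₂ κ₃ = 0 := by
    have hd : κ₁ - κ₀ ≠ 0 := (sub_pos.2 h1).ne'
    set p := J κ₁ κ₂ - (κ₂ - κ₁) * J κ₀ κ₁ / (κ₁ - κ₀) with hp
    set q := J κ₂ κ₃ - (κ₃ - κ₂) * J κ₀ κ₁ / (κ₁ - κ₀) with hq
    have key : ∀ s₂ s₃ : ℝ, s₂ * p + s₃ * q = 0 → ¬(s₂ = 0 ∧ s₃ = 0) →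
        ∃ s₁ s₂ s₃ : ℝ, ¬(s₁ = 0 ∧ s₂ = 0 ∧ s₃ = 0) ∧
        s₁ * (κ₁ - κ₀) + s₂ * (κ₂ - κ₁) + s₃ * (κ₃ - κ₂) = 0 ∧
        s₁ * J κ₀ κ₁ + s₂ * J κ₁ κ₂ + s₃ * J κ₂ κ₃ = 0 := fun s₂ s₃ h hn =>
      ⟨-(s₂ * (κ₂ - κ₁) + s₃ * (κ₃ - κ₂)) / (κ₁ - κ₀), s₂, s₃, fun h' => hn h'.2,
        by field_simp; ring, by rw [← h, hp, hq]; field_simp; ring⟩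
    by_cases hpq : p = 0 ∧ q = 0
    · exact key 1 0 (by rw [hpq.1]; ring) (by simp)
    · exact key q (-p) (by ring) (fun h => hpq ⟨neg_eq_zero.1 h.2, h.1⟩)
  set N := |s₁| + |s₂| + |s₃| with hN
  have hNpos : 0 < N := by
    rcases (by positivity : 0 ≤ N).eq_or_lt with h | h
    · refine absurd ?_ hne
      have a1 := abs_nonneg s₁
      have a2 := abs_nonneg s₂
      have a3 := abs_nonneg s₃
      exact ⟨abs_eq_zero.1 (by linarith), abs_eq_zero.1 (by linarith),
        abs_eq_zero.1 (by linarith)⟩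
    · exact h
  set δ := ε / N with hδ
  have hδpos : 0 < δ := div_pos hε hNpos
  have hδN : δ * N = ε := div_mul_cancel₀ _ hNpos.ne'
  set ψ : ℝ → ℝ := fun s => δ * s₁ * truncation κ₀ κ₁ s + δ * s₂ * truncation κ₁ κ₂ s
    + δ * s₃ * truncation κ₂ κ₃ s with hψ
  have hsmall : ∀ s, |s| ≤ N → |δ * s| ≤ ε := fun s hs => by
    rw [abs_mul, abs_of_pos hδpos, ← hδN]
    gcongr
  have a1 := abs_nonneg s₁
  have a2 := abs_nonneg s₂
  have a3 := abs_nonneg s₃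
  refine ⟨ψ, δ * s₁, δ * s₂, δ * s₃, ?_, ?_, ?_, ?_,
    ⟨hsmall _ (by linarith), hsmall _ (by linarith), hsmall _ (by linarith)⟩, ?_, ?_, ?_, ?_⟩
  · intro s t
    have e : ψ s - ψ t = δ * (s₁ * (truncation κ₀ κ₁ s - truncation κ₀ κ₁ t)
        + s₂ * (truncation κ₁ κ₂ s - truncation κ₁ κ₂ t)
        + s₃ * (truncation κ₂ κ₃ s - truncation κ₂ κ₃ t)) := by
      simp only [hψ]; ring
    rw [e, abs_mul, abs_of_pos hδpos, ← hδN, mul_assoc]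
    refine mul_le_mul_of_nonneg_left ?_ hδpos.le
    refine (abs_add_three _ _ _).trans ?_
    simp only [abs_mul, hN, add_mul]
    exact add_le_add (add_le_add (mul_le_mul_of_nonneg_left (abs_truncation_sub_le _ _ _ _) a1)
      (mul_le_mul_of_nonneg_left (abs_truncation_sub_le _ _ _ _) a2))
      (mul_le_mul_of_nonneg_left (abs_truncation_sub_le _ _ _ _) a3)
  · intro s hs
    simp only [hψ]
    rw [truncation_of_le hs h1.le, truncation_of_le (by linarith) h2.le,
      truncation_of_le (by linarith) h3.le]
    ring
  · intro s hs
    simp only [hψ]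
    rw [truncation_of_ge (by linarith) h1.le, truncation_of_ge (by linarith) h2.le,
      truncation_of_ge hs h3.le]
    linear_combination δ * hd
  · by_contra hcon
    push Not at hcon
    obtain ⟨e1, e2⟩ := hcon
    simp only [hψ] at e1 e2
    rw [truncation_of_ge le_rfl h1.le, truncation_of_le le_rfl h2.le,
      truncation_of_le h2.le h3.le] at e1
    rw [truncation_of_ge h2.le h1.le, truncation_of_ge le_rfl h2.le,
      truncation_of_le le_rfl h3.le] at e2
    have f1 : s₁ = 0 := by
      have : δ * s₁ * (κ₁ - κ₀) = 0 := by linarith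
      simpa [hδpos.ne', (sub_pos.2 h1).ne'] using this
    rw [f1] at e2 hd
    have f2 : s₂ = 0 := by
      have : δ * s₂ * (κ₂ - κ₁) = 0 := by linarith
      simpa [hδpos.ne', (sub_pos.2 h2).ne'] using this
    rw [f2] at hd
    have f3 : s₃ = 0 := by
      have : s₃ * (κ₃ - κ₂) = 0 := by linarith
      simpa [(sub_pos.2 h3).ne'] using this
    exact hne ⟨f1, f2, f3⟩
  · intro s hs t ht
    simp only [hψ]
    rw [truncation_of_mem hs, truncation_of_mem ht, truncation_of_le hs.2 h2.le,
      truncation_of_le ht.2 h2.le, truncation_of_le (hs.2.trans h2.le) h3.le,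
      truncation_of_le (ht.2.trans h2.le) h3.le]
    ring
  · intro s hs t ht
    simp only [hψ]
    rw [truncation_of_mem hs, truncation_of_mem ht, truncation_of_ge hs.1 h1.le,
      truncation_of_ge ht.1 h1.le, truncation_of_le hs.2 h3.le, truncation_of_le ht.2 h3.le]
    ring
  · intro s hs t ht
    simp only [hψ]
    rw [truncation_of_mem hs, truncation_of_mem ht, truncation_of_ge hs.1 h2.le,
      truncation_of_ge ht.1 h2.le, truncation_of_ge (h2.le.trans hs.1) h1.le,
      truncation_of_ge (h2.le.trans ht.1) h1.le]
    ring
  · have hi : ∀ l r, IntervalIntegrable (fun v => truncation l r (b v)) volume x y := fun l r =>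
      Monotone.intervalIntegrable ((monotone_truncation l r).comp hb)
    simp only [hψ]
    rw [intervalIntegral.integral_add (((hi _ _).const_mul _).add ((hi _ _).const_mul _))
        ((hi _ _).const_mul _),
      intervalIntegral.integral_add ((hi _ _).const_mul _) ((hi _ _).const_mul _),
      intervalIntegral.integral_const_mul, intervalIntegral.integral_const_mul,
      intervalIntegral.integral_const_mul]
    simp only [hJ] at hint
    linear_combination δ * hint

theorem exists_four_of_infinite_image {b : ℝ → ℝ} {S : Set ℝ} (h : (b '' S).Infinite) : ∃ t₀ ∈ S, ∃ t₁ ∈ S, ∃ t₂ ∈ S, ∃ t₃ ∈ S,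
      b t₀ < b t₁ ∧ b t₁ < b t₂ ∧ b t₂ < b t₃ := by
  obtain ⟨F, hF, hcard⟩ := h.exists_subset_card_eq 4
  have hmem : ∀ i, ∃ t ∈ S, b t = F.orderEmbOfFin hcard i := fun i =>
    hF (F.orderEmbOfFin_mem hcard i)
  choose t ht hbt using hmem
  have hlt : ∀ i j : Fin 4, i < j → b (t i) < b (t j) := fun i j hij => by
    rw [hbt, hbt]; exact (F.orderEmbOfFin hcard).strictMono hij
  exact ⟨t 0, ht 0, t 1, ht 1, t 2, ht 2, t 3, ht 3, hlt 0 1 (by decide), hlt 1 2 (by decide),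
    hlt 2 3 (by decide)⟩

namespace AuctionInstance

variable (I : AuctionInstance)

/-- A vertex of the feasible set: a feasible allocation rule that is not the midpoint of two other
feasible rules. -/
def IsVertex (a : Item → ℝ → ℝ) : Prop :=
  a ∈ I.feasibleSet ∧ ∀ w, a + w ∈ I.feasibleSet → a - w ∈ I.feasibleSet → w = 0

/-- An extreme point of the set of maximizers is a vertex of the feasible set. -/
theorem exists_isVertex_optimal :
    ∃ a, I.IsVertex a ∧ ∀ b ∈ I.feasibleSet, I.primalValue b ≤ I.primalValue a := by
  have hcont : ContinuousOn I.primalValue I.feasibleSet :=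
    I.continuousOn_primalValue.mono fun a ha => ha.1
  obtain ⟨m, hm, hmax⟩ := I.isCompact_feasibleSet.exists_isMaxOn ⟨0, I.zero_mem_feasibleSet⟩ hcont
  set M := {a | a ∈ I.feasibleSet ∧ I.primalValue m ≤ I.primalValue a} with hM
  have hMc : IsCompact M := I.isCompact_feasibleSet.of_isClosed_subset
    (hcont.preimage_isClosed_of_isClosed I.isCompact_feasibleSet.isClosed isClosed_Ici)
    fun a ha => ha.1
  obtain ⟨a, haM, hext⟩ := hMc.extremePoints_nonempty ⟨m, hm, le_rfl⟩
  refine ⟨a, ⟨haM.1, fun w h1 h2 => ?_⟩, fun b hb => (hmax hb).trans haM.2⟩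
  have hmid : (1 / 2 : ℝ) • (a + w) + (1 / 2 : ℝ) • (a - w) = a := by
    rw [← smul_add, add_add_sub_cancel, ← two_smul ℝ a, smul_smul]; norm_num
  have hval := I.primalValue_combo h1.1 h2.1 (1 / 2) (1 / 2)
  rw [hmid] at hval
  have l1 : I.primalValue (a + w) ≤ I.primalValue m := hmax h1
  have l2 : I.primalValue (a - w) ≤ I.primalValue m := hmax h2
  have l3 := haM.2
  have hw : a + w = a := hext (x₁ := a + w) ⟨h1, by linarith⟩ (x₂ := a - w) ⟨h2, by linarith⟩
    ⟨1 / 2, 1 / 2, by norm_num, by norm_num, by norm_num, hmid⟩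
  simpa using hw

variable {I} {a : Item → ℝ → ℝ}

/-- At a point `e` where `u_C = u_X`, the slope of `u_C ≥ u_X` passes the slope of `u_X`. -/
theorem le_of_touch (ha : a ∈ I.feasibleSet) {X : Item} {e v : ℝ} (he : e ∈ Icc 0 I.H)
    (htouch : utility a Item.C e = utility a X e) (hv : v ∈ Icc 0 I.H) :
    (v < e → a Item.C v ≤ a X e) ∧ (e < v → a X e ≤ a Item.C v) := by
  have hC := (ha.1 Item.C).1.monotoneOn (Icc 0 I.H)
  have hX := (ha.1 X).1.monotoneOn (Icc 0 I.H)
  have huv := ha.2 X v hv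
  simp only [utility] at htouch huv
  constructor <;> intro h
  · have h1 := mul_le_integral_of_monotoneOn hC hv he h.le
    have h2 := integral_le_mul_of_monotoneOn hX hv he h.le
    have h3 := integral_sub_integral_of_monotoneOn hC hv he
    have h4 := integral_sub_integral_of_monotoneOn hX hv he
    exact le_of_mul_le_mul_left (a := e - v) (by linarith) (sub_pos.2 h)
  · have h1 := integral_le_mul_of_monotoneOn hC he hv h.le
    have h2 := mul_le_integral_of_monotoneOn hX he hv h.le
    have h3 := integral_sub_integral_of_monotoneOn hC he hv
    have h4 := integral_sub_integral_of_monotoneOn hX he hv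
    exact le_of_mul_le_mul_left (a := v - e) (by linarith) (sub_pos.2 h)

theorem add_comp_mem_monotoneUnit {b ψ : ℝ → ℝ} (hb : b ∈ monotoneUnit)
    (hlip : ∀ s t, |ψ s - ψ t| ≤ |s - t|) (h0 : ψ 0 = 0) (h1 : ψ 1 = 0) :
    (fun v => b v + ψ (b v)) ∈ monotoneUnit := by
  have hm : Monotone fun s => s + ψ s := fun s t hst => by
    have := hlip s t
    rw [abs_sub_comm s, abs_of_nonneg (sub_nonneg.2 hst)] at this
    have := (abs_le.1 this).2
    simp only; linarith
  refine ⟨hm.comp hb.1, fun v => ⟨?_, ?_⟩⟩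
  · simpa [h0] using hm (hb.2 v).1
  · simpa [h1] using hm (hb.2 v).2

/-- A vertex admits no perturbation `a G + ψ ∘ a G` of the items in `P` that is supported in an
interval, leaves the utilities at its ends unchanged, and moves utilities by at most the slack in
the utility constraints. -/
theorem IsVertex.comp_eq_zero (ha : I.IsVertex a) (P : Item → Prop) [DecidablePred P]
    {ψ : ℝ → ℝ} (hlip : ∀ s t, |ψ s - ψ t| ≤ |s - t|) (h0 : ψ 0 = 0) (h1 : ψ 1 = 0)
    {x y : ℝ} (hx : 0 ≤ x) (hout : ∀ G, P G → ∀ v, v ∉ Icc x y → ψ (a G v) = 0)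
    (hint : ∀ G, P G → ∫ v in x..y, ψ (a G v) = 0)
    (hgap : ∀ G, ∀ v ∈ Icc x y, |(∫ w in x..v, if P Item.C then ψ (a Item.C w) else 0)
      - ∫ w in x..v, if P G then ψ (a G w) else 0| ≤ utility a Item.C v - utility a G v)
    {G : Item} (hG : P G) (v : ℝ) : ψ (a G v) = 0 := by
  set w : Item → ℝ → ℝ := fun G v => if P G then ψ (a G v) else 0 with hw
  have hplus : ∀ G, (a + w) G ∈ monotoneUnit := fun G => by
    by_cases h : P G
    · convert add_comp_mem_monotoneUnit (ha.1.1 G) hlip h0 h1 using 1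
      ext v; simp [hw, h]
    · convert ha.1.1 G using 1
      ext v; simp [hw, h]
  have hminus : ∀ G, (a - w) G ∈ monotoneUnit := fun G => by
    by_cases h : P G
    · convert add_comp_mem_monotoneUnit (ψ := fun s => -ψ s) (ha.1.1 G)
        (fun s t => by rw [neg_sub_neg, abs_sub_comm]; exact hlip s t) (by simp [h0])
        (by simp [h1]) using 1
      ext v; simp [hw, h, sub_eq_add_neg]
    · convert ha.1.1 G using 1
      ext v; simp [hw, h]
  have hai : ∀ G s t, IntervalIntegrable (a G) volume s t := fun G s t =>
    monotoneUnit.intervalIntegrable (ha.1.1 G) s t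
  have hwi : ∀ G s t, IntervalIntegrable (w G) volume s t := fun G s t => by
    convert (monotoneUnit.intervalIntegrable (hplus G) s t).sub (hai G s t) using 1
    ext v; simp
  have hwout : ∀ G v, v ∉ Icc x y → w G v = 0 := fun G v hv => by
    by_cases h : P G
    · simp [hw, h, hout G h v hv]
    · simp [hw, h]
  have hleft : ∀ G, ∀ v, 0 ≤ v → v ≤ x → ∫ u in (0 : ℝ)..v, w G u = 0 := fun G v hv hvx => by
    have : ∫ u in (0 : ℝ)..v, w G u = ∫ u in (0 : ℝ)..v, (0 : ℝ) :=
      intervalIntegral.integral_congr_uIoo fun u hu => by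
        rw [uIoo_of_le hv] at hu
        exact hwout G u fun h => absurd h.1 (not_le.2 (hu.2.trans_le hvx))
    simpa using this
  have hright : ∀ G, ∀ v, y ≤ v → ∫ u in y..v, w G u = 0 := fun G v hv => by
    have : ∫ u in y..v, w G u = ∫ u in y..v, (0 : ℝ) :=
      intervalIntegral.integral_congr_uIoo fun u hu => by
        rw [uIoo_of_le hv] at hu
        exact hwout G u fun h => absurd h.2 (not_le.2 hu.1)
    simpa using this
  have hmid : ∀ G, ∫ u in x..y, w G u = 0 := fun G => by
    by_cases h : P G
    · simpa [hw, h] using hint G h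
    · simp [hw, h]
  have hfrom : ∀ G, ∀ v, ∫ u in (0 : ℝ)..v, w G u = ∫ u in x..v, w G u := fun G v => by
    rw [← intervalIntegral.integral_add_adjacent_intervals (hwi G 0 x) (hwi G x v),
      hleft G x hx le_rfl, zero_add]
  have hsmall : ∀ G, ∀ v ∈ Icc 0 I.H,
      |(∫ u in (0 : ℝ)..v, w Item.C u) - ∫ u in (0 : ℝ)..v, w G u|
        ≤ utility a Item.C v - utility a G v := by
    intro G v hv
    rcases le_total v x with h | h
    · rw [hleft _ v hv.1 h, hleft _ v hv.1 h, sub_self, abs_zero]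
      exact sub_nonneg.2 (ha.1.2 G v hv)
    rcases le_total v y with h' | h'
    · rw [hfrom, hfrom]
      exact hgap G v ⟨h, h'⟩
    · have : ∀ G, ∫ u in (0 : ℝ)..v, w G u = 0 := fun G => by
        rw [hfrom, ← intervalIntegral.integral_add_adjacent_intervals (hwi G x y) (hwi G y v),
          hmid, hright G v h', zero_add]
      rw [this, this, sub_self, abs_zero]
      exact sub_nonneg.2 (ha.1.2 G v hv)
  have hup : ∀ G v, utility (a + w) G v = utility a G v + ∫ u in (0 : ℝ)..v, w G u := fun G v =>
    intervalIntegral.integral_add (hai G 0 v) (hwi G 0 v)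
  have hum : ∀ G v, utility (a - w) G v = utility a G v - ∫ u in (0 : ℝ)..v, w G u := fun G v =>
    intervalIntegral.integral_sub (hai G 0 v) (hwi G 0 v)
  have hzero := ha.2 w ⟨hplus, fun G v hv => by
      rw [hup, hup]; linarith [(abs_le.1 (hsmall G v hv)).1]⟩
    ⟨hminus, fun G v hv => by
      rw [hum, hum]; linarith [(abs_le.1 (hsmall G v hv)).2]⟩
  have := congrFun (congrFun hzero G) v
  simpa [hw, hG] using this

theorem exists_pos_le_gap (ha : a ∈ I.feasibleSet) {x y : ℝ} (hxy : x ≤ y) {Q : Item → Prop}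
    (hpos : ∀ v ∈ Icc x y, ∀ G, Q G → utility a G v < utility a Item.C v) :
    ∃ η > 0, ∀ v ∈ Icc x y, ∀ G, Q G → η ≤ utility a Item.C v - utility a G v := by
  have h : ∀ G, ∃ η > 0, Q G → ∀ v ∈ Icc x y, η ≤ utility a Item.C v - utility a G v := fun G => by
    by_cases hQ : Q G
    · obtain ⟨t, ht, hmin⟩ := (isCompact_Icc (a := x) (b := y)).exists_isMinOn
        (nonempty_Icc.2 hxy)
        ((continuous_utility ha.1 Item.C).sub (continuous_utility ha.1 G)).continuousOn
      exact ⟨_, sub_pos.2 (hpos t ht G hQ), fun _ v hv => hmin hv⟩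
    · exact ⟨1, one_pos, fun h => absurd h hQ⟩
  choose η hη hle using h
  refine ⟨min (η Item.A) (min (η Item.B) (η Item.C)),
    lt_min (hη _) (lt_min (hη _) (hη _)), fun v hv G hQ => le_trans ?_ (hle G hQ v hv)⟩
  cases G <;> simp

theorem abs_integral_comp_le {b ψ : ℝ → ℝ} (hb : b ∈ monotoneUnit) {ε : ℝ} (hε : 0 ≤ ε)
    (hlip : ∀ s t, |ψ s - ψ t| ≤ ε * |s - t|) (h0 : ψ 0 = 0) {x v L : ℝ} (hx : 0 ≤ x)
    (hxv : x ≤ v) (hv : v ≤ L) : |∫ w in x..v, ψ (b w)| ≤ ε * L := by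
  have h1 := intervalIntegral.norm_integral_le_of_norm_le_const (a := x) (b := v)
    (f := fun w => ψ (b w)) (C := ε) fun w _ => by
      have h2 := hlip (b w) 0
      rw [h0, sub_zero, sub_zero] at h2
      have h3 := monotoneUnit.norm_le hb w
      rw [Real.norm_eq_abs] at h3 ⊢
      nlinarith
  rw [abs_of_nonneg (sub_nonneg.2 hxv)] at h1
  exact h1.trans (mul_le_mul_of_nonneg_left (by linarith) hε)

theorem exists_lipschitz_bound {L η : ℝ} (hL : 0 < L) (hη : 0 < η) :
    ∃ ε > 0, ε ≤ 1 ∧ ε * L ≤ η :=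
  ⟨min 1 (η / L), lt_min one_pos (div_pos hη hL), min_le_left _ _,
    (mul_le_mul_of_nonneg_right (min_le_right _ _) hL.le).trans (div_mul_cancel₀ _ hL.ne').le⟩

/-- Where all utility constraints that involve `X` are slack, a vertex has no more than three
values of `a X`. -/
theorem IsVertex.finite_image_of_slack (ha : I.IsVertex a) {X : Item} {x y : ℝ}
    (hJ : Ioo x y ⊆ Ioo 0 I.H)
    (hpos : ∀ v ∈ Ioo x y, ∀ G, G ≠ Item.C → (X = Item.C ∨ G = X) →
      utility a G v < utility a Item.C v) : (a X '' Ioo x y).Finite := by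
  by_contra hinf
  obtain ⟨t₀, h0, t₁, h1, t₂, h2, t₃, h3, l1, l2, l3⟩ :=
    exists_four_of_infinite_image hinf
  have hm := (ha.1.1 X).1
  have h03 : t₀ < t₃ := hm.reflect_lt (l1.trans (l2.trans l3))
  have hsub : Icc t₀ t₃ ⊆ Ioo x y := fun v hv => ⟨h0.1.trans_le hv.1, hv.2.trans_lt h3.2⟩
  obtain ⟨η, hη, hgap⟩ := exists_pos_le_gap ha.1 h03.le
    (Q := fun G => G ≠ Item.C ∧ (X = Item.C ∨ G = X))
    fun v hv G hQ => hpos v (hsub hv) G hQ.1 hQ.2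
  obtain ⟨ε, hε, hε1, hεH⟩ := exists_lipschitz_bound I.H_pos hη
  obtain ⟨ψ, s₁, s₂, s₃, hlip, hlo, hhi, hne, -, -, -, -, hint⟩ :=
    exists_perturbation l1 l2 l3 hm t₀ t₃ hε
  have hψ0 : ψ 0 = 0 := hlo 0 ((ha.1.1 X).2 t₀).1
  have hψ1 : ψ 1 = 0 := hhi 1 ((ha.1.1 X).2 t₃).2
  have hzero := ha.comp_eq_zero (fun G => G = X) (ψ := ψ)
    (fun s t => (hlip s t).trans (mul_le_of_le_one_left (abs_nonneg _) hε1)) hψ0 hψ1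
    (hJ h0).1.le
    (by
      rintro G rfl v hv
      rw [mem_Icc, not_and_or, not_le, not_le] at hv
      rcases hv with hv | hv
      · exact hlo _ (hm hv.le)
      · exact hhi _ (hm hv.le))
    (by rintro G rfl; exact hint)
    (by
      intro G v hv
      have hb := abs_integral_comp_le (ha.1.1 X) hε.le hlip hψ0 (hJ h0).1.le hv.1
        (hJ (hsub hv)).2.le
      have hnn : 0 ≤ utility a Item.C v - utility a G v :=
        sub_nonneg.2 (ha.1.2 G v (Ioo_subset_Icc_self (hJ (hsub hv))))
      by_cases hGC : G = Item.C
      · subst hGC; simp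
      by_cases hX : X = Item.C
      · subst hX
        have := hgap v hv G ⟨hGC, Or.inl rfl⟩
        simp only [if_true, if_neg hGC, intervalIntegral.integral_zero, sub_zero]
        linarith
      · simp only [if_neg (Ne.symm hX), intervalIntegral.integral_zero, zero_sub, abs_neg]
        by_cases hGX : G = X
        · subst hGX
          have := hgap v hv G ⟨hGC, Or.inr rfl⟩
          simp only [if_true]
          linarith
        · simpa [hGX] using hnn)
    (G := X) rfl
  exact hne.elim (fun h => h (hzero t₁)) fun h => h (hzero t₂)

theorem integral_comp_sub_of_touch (ha : a ∈ I.feasibleSet) {X : Item} {e e' v : ℝ}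
    (he : e ∈ Ioo 0 I.H) (he' : e' ∈ Ioo 0 I.H)
    (ht : utility a Item.C e = utility a X e) (ht' : utility a Item.C e' = utility a X e')
    {ψ : ℝ → ℝ} {s : ℝ}
    (hψ : ∀ p ∈ Icc (a X e) (a X e'), ∀ q ∈ Icc (a X e) (a X e'), ψ p - ψ q = s * (p - q))
    (hv : v ∈ Icc e e') :
    ∫ w in e..v, (ψ (a Item.C w) - ψ (a X w)) = s * (utility a Item.C v - utility a X v) := by
  have hi : ∀ G s t, IntervalIntegrable (a G) volume s t := fun G s t =>
    monotoneUnit.intervalIntegrable (ha.1 G) s t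
  have h1 : ∫ w in e..v, (ψ (a Item.C w) - ψ (a X w))
      = ∫ w in e..v, s * (a Item.C w - a X w) := by
    refine intervalIntegral.integral_congr_uIoo fun w hw => ?_
    rw [uIoo_of_le hv.1] at hw
    have hwe' : w < e' := hw.2.trans_le hv.2
    have hwI : w ∈ Icc 0 I.H := ⟨(he.1.trans hw.1).le, (hwe'.trans he'.2).le⟩
    exact hψ _ ⟨(le_of_touch ha (Ioo_subset_Icc_self he) ht hwI).2 hw.1,
      (le_of_touch ha (Ioo_subset_Icc_self he') ht' hwI).1 hwe'⟩ _
      ⟨(ha.1 X).1 hw.1.le, (ha.1 X).1 hwe'.le⟩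
  have h2 : ∀ G, ∫ w in e..v, a G w = utility a G v - utility a G e := fun G =>
    (intervalIntegral.integral_interval_sub_left (hi G _ _) (hi G _ _)).symm
  rw [h1, intervalIntegral.integral_const_mul, intervalIntegral.integral_sub (hi _ _ _) (hi _ _ _),
    h2, h2, ht]
  ring

/-- Where the utility constraints of the items other than `X` are slack, a vertex has no more than
three values of `a X` at points with `u_C = u_X`. Between such points the slopes of `u_C` and `u_X`
range over the same values, so the *same* `ψ` perturbs both items, and it scales the gap
`u_C - u_X` by a factor close to `1`. -/
theorem IsVertex.finite_image_touch (ha : I.IsVertex a) {X : Item} {x y : ℝ}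
    (hJ : Ioo x y ⊆ Ioo 0 I.H)
    (hpos : ∀ v ∈ Ioo x y, ∀ G, G ≠ Item.C → G ≠ X → utility a G v < utility a Item.C v) :
    (a X '' {e | e ∈ Ioo x y ∧ utility a Item.C e = utility a X e}).Finite := by
  by_contra hinf
  obtain ⟨t₀, ⟨h0, e0⟩, t₁, ⟨h1, e1⟩, t₂, ⟨h2, e2⟩, t₃, ⟨h3, e3⟩, l1, l2, l3⟩ :=
    exists_four_of_infinite_image hinf
  have hm := (ha.1.1 X).1
  have h01 : t₀ < t₁ := hm.reflect_lt l1
  have h12 : t₁ < t₂ := hm.reflect_lt l2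
  have h23 : t₂ < t₃ := hm.reflect_lt l3
  have h03 : t₀ < t₃ := h01.trans (h12.trans h23)
  have hsub : Icc t₀ t₃ ⊆ Ioo x y := fun v hv => ⟨h0.1.trans_le hv.1, hv.2.trans_lt h3.2⟩
  obtain ⟨η, hη, hgap⟩ := exists_pos_le_gap ha.1 h03.le (Q := fun G => G ≠ Item.C ∧ G ≠ X)
    fun v hv G hQ => hpos v (hsub hv) G hQ.1 hQ.2
  obtain ⟨ε, hε, hε1, hεH⟩ := exists_lipschitz_bound I.H_pos hη
  obtain ⟨ψ, s₁, s₂, s₃, hlip, hlo, hhi, hne, ⟨b1, b2, b3⟩, p1, p2, p3, hint⟩ :=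
    exists_perturbation l1 l2 l3 (ha.1.1 Item.C).1 t₀ t₃ hε
  have hψ0 : ψ 0 = 0 := hlo 0 ((ha.1.1 X).2 t₀).1
  have hψ1 : ψ 1 = 0 := hhi 1 ((ha.1.1 X).2 t₃).2
  have hlip1 : ∀ s t, |ψ s - ψ t| ≤ |s - t| := fun s t =>
    (hlip s t).trans (mul_le_of_le_one_left (abs_nonneg _) hε1)
  have hψi : ∀ G s t, IntervalIntegrable (fun v => ψ (a G v)) volume s t := fun G s t => by
    have := (monotoneUnit.intervalIntegrable
      (add_comp_mem_monotoneUnit (ha.1.1 G) hlip1 hψ0 hψ1) s t).sub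
      (monotoneUnit.intervalIntegrable (ha.1.1 G) s t)
    simpa using this
  have hdi : ∀ s t, IntervalIntegrable (fun v => ψ (a Item.C v) - ψ (a X v)) volume s t :=
    fun s t => (hψi _ s t).sub (hψi _ s t)
  have c1 := fun v hv => integral_comp_sub_of_touch (v := v) ha.1 (hJ h0) (hJ h1) e0 e1 p1 hv
  have c2 := fun v hv => integral_comp_sub_of_touch (v := v) ha.1 (hJ h1) (hJ h2) e1 e2 p2 hv
  have c3 := fun v hv => integral_comp_sub_of_touch (v := v) ha.1 (hJ h2) (hJ h3) e2 e3 p3 hv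
  have z1 : ∫ w in t₀..t₁, (ψ (a Item.C w) - ψ (a X w)) = 0 := by
    rw [c1 t₁ ⟨h01.le, le_rfl⟩, e1, sub_self, mul_zero]
  have z2 : ∫ w in t₀..t₂, (ψ (a Item.C w) - ψ (a X w)) = 0 := by
    rw [← intervalIntegral.integral_add_adjacent_intervals (hdi t₀ t₁) (hdi t₁ t₂), z1,
      c2 t₂ ⟨h12.le, le_rfl⟩, e2, sub_self, mul_zero, add_zero]
  have hscale : ∀ v ∈ Icc t₀ t₃, ∃ s, |s| ≤ ε ∧ ∫ w in t₀..v, (ψ (a Item.C w) - ψ (a X w))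
      = s * (utility a Item.C v - utility a X v) := by
    intro v hv
    rcases le_total v t₁ with hv1 | hv1
    · exact ⟨s₁, b1, c1 v ⟨hv.1, hv1⟩⟩
    rcases le_total v t₂ with hv2 | hv2
    · refine ⟨s₂, b2, ?_⟩
      rw [← intervalIntegral.integral_add_adjacent_intervals (hdi t₀ t₁) (hdi t₁ v), z1, zero_add]
      exact c2 v ⟨hv1, hv2⟩
    · refine ⟨s₃, b3, ?_⟩
      rw [← intervalIntegral.integral_add_adjacent_intervals (hdi t₀ t₂) (hdi t₂ v), z2, zero_add]
      exact c3 v ⟨hv2, hv.2⟩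
  have hintX : ∫ w in t₀..t₃, ψ (a X w) = 0 := by
    obtain ⟨s, -, hs⟩ := hscale t₃ ⟨h03.le, le_rfl⟩
    rw [intervalIntegral.integral_sub (hψi _ _ _) (hψi _ _ _), hint, e3] at hs
    linarith
  have hout : ∀ G, (G = Item.C ∨ G = X) → ∀ v, v ∉ Icc t₀ t₃ → ψ (a G v) = 0 := by
    intro G hG v hv
    rw [mem_Icc, not_and_or, not_le, not_le] at hv
    have hH := I.H_pos.le
    rcases hG with rfl | rfl
    · rcases hv with hv | hv
      · -- `max v 0` lies in `[0, t₀)`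
        refine hlo _ (((ha.1.1 Item.C).1 (le_max_left v 0)).trans ?_)
        have hlt : max v 0 < t₀ := max_lt hv (hJ h0).1
        exact (le_of_touch ha.1 (Ioo_subset_Icc_self (hJ h0)) e0
          ⟨le_max_right _ _, (hlt.trans (hJ h0).2).le⟩).1 hlt
      · refine hhi _ (le_trans ?_ ((ha.1.1 Item.C).1 (min_le_left v I.H)))
        have hlt : t₃ < min v I.H := lt_min hv (hJ h3).2
        exact (le_of_touch ha.1 (Ioo_subset_Icc_self (hJ h3)) e3
          ⟨((hJ h3).1.trans hlt).le, min_le_right _ _⟩).2 hlt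
    · rcases hv with hv | hv
      · exact hlo _ (hm hv.le)
      · exact hhi _ (hm hv.le)
  have hzero := ha.comp_eq_zero (fun G => G = Item.C ∨ G = X) (ψ := ψ) hlip1 hψ0 hψ1
    (hJ h0).1.le hout (by rintro G (rfl | rfl); exacts [hint, hintX])
    (by
      intro G v hv
      have hnn : 0 ≤ utility a Item.C v - utility a G v :=
        sub_nonneg.2 (ha.1.2 G v (Ioo_subset_Icc_self (hJ (hsub hv))))
      by_cases hGC : G = Item.C
      · subst hGC; simp
      by_cases hGX : G = X
      · subst hGX
        obtain ⟨s, hs, hse⟩ := hscale v hv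
        simp only [or_true, true_or, if_true]
        rw [← intervalIntegral.integral_sub (hψi _ _ _) (hψi _ _ _), hse, abs_mul,
          abs_of_nonneg hnn]
        exact mul_le_of_le_one_left hnn (hs.trans hε1)
      · have hb := abs_integral_comp_le (ha.1.1 Item.C) hε.le hlip hψ0 (hJ h0).1.le hv.1
          (hJ (hsub hv)).2.le
        have := hgap v hv G ⟨hGC, hGX⟩
        simp only [true_or, if_true, hGC, hGX, or_self, if_false, intervalIntegral.integral_zero,
          sub_zero]
        linarith)
    (G := X) (Or.inr rfl)
  exact hne.elim (fun h => h (hzero t₁)) fun h => h (hzero t₂)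

end AuctionInstance

/-! ### Values near an accumulation point -/

/-- What the filters `𝓝[<] p` and `𝓝[>] p` have in common: they are generated by open intervals, and
a point close enough to the limit lies between two members of any set that accumulates there. -/
structure IsOneSided (l : Filter ℝ) : Prop where
  exists_Ioo : ∀ s ∈ l, ∃ x y, Ioo x y ∈ l ∧ Ioo x y ⊆ s
  sandwich : ∀ P : ℝ → Prop, (∃ᶠ v in l, P v) → ∀ᶠ v in l, ∃ e e', e < v ∧ v < e' ∧ P e ∧ P e'

theorem isOneSided_nhdsLT (p : ℝ) : IsOneSided (𝓝[<] p) := by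
  refine ⟨fun s hs => ?_, fun P hP => ?_⟩
  · obtain ⟨x, hx, hxs⟩ := (mem_nhdsLT_iff_exists_Ioo_subset).1 hs
    exact ⟨x, p, Ioo_mem_nhdsLT hx, hxs⟩
  · obtain ⟨e, he, hep⟩ := (hP.and_eventually self_mem_nhdsWithin).exists
    filter_upwards [Ioo_mem_nhdsLT hep] with v hv
    obtain ⟨e', he', hve', -⟩ := (hP.and_eventually (Ioo_mem_nhdsLT hv.2)).exists
    exact ⟨e, e', hv.1, hve', he, he'⟩

theorem isOneSided_nhdsGT (p : ℝ) : IsOneSided (𝓝[>] p) := by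
  refine ⟨fun s hs => ?_, fun P hP => ?_⟩
  · obtain ⟨y, hy, hys⟩ := (mem_nhdsGT_iff_exists_Ioo_subset).1 hs
    exact ⟨p, y, Ioo_mem_nhdsGT hy, hys⟩
  · obtain ⟨e', he', hep⟩ := (hP.and_eventually self_mem_nhdsWithin).exists
    filter_upwards [Ioo_mem_nhdsGT hep] with v hv
    obtain ⟨e, he, -, hev⟩ := (hP.and_eventually (Ioo_mem_nhdsGT hv.1)).exists
    exact ⟨e, e', hev, hv.2, he, he'⟩

/-- The allocation rule `a` has finitely many values for item `G` near the limit of `l`. -/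
def FinitelyValued (a : Item → ℝ → ℝ) (l : Filter ℝ) (G : Item) : Prop :=
  ∃ s ∈ l, (a G '' s).Finite

theorem finitelyValued_of_eventually_eq {a : Item → ℝ → ℝ} {l : Filter ℝ} {G : Item} {κ : ℝ}
    (h : ∀ᶠ v in l, a G v = κ) : FinitelyValued a l G :=
  ⟨_, h, (finite_singleton κ).subset (by rintro _ ⟨v, hv, rfl⟩; exact hv)⟩

namespace AuctionInstance

variable {I : AuctionInstance} {a : Item → ℝ → ℝ}

section OneSided

variable {l : Filter ℝ}

theorem eventually_utility_lt (ha : a ∈ I.feasibleSet) (hI : Ioo 0 I.H ∈ l) {X : Item}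
    (h : ¬∃ᶠ v in l, utility a Item.C v = utility a X v) :
    ∀ᶠ v in l, utility a X v < utility a Item.C v := by
  filter_upwards [not_frequently.1 h, hI] with v hv hvI
  exact lt_of_le_of_ne (ha.2 X v (Ioo_subset_Icc_self hvI)) (Ne.symm hv)

theorem IsVertex.finitelyValued_of_slack (ha : I.IsVertex a) (hl : IsOneSided l)
    (hI : Ioo 0 I.H ∈ l) {X : Item}
    (h : ∀ᶠ v in l, ∀ G, G ≠ Item.C → (X = Item.C ∨ G = X) →
      utility a G v < utility a Item.C v) : FinitelyValued a l X := by
  obtain ⟨x, y, hJ, hsub⟩ := hl.exists_Ioo _ (inter_mem h hI)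
  exact ⟨_, hJ, ha.finite_image_of_slack (fun v hv => (hsub hv).2) fun v hv => (hsub hv).1⟩

/-- If no mass of `C` accumulates, then for each item `X` either `u_X` touches the affine function
`u_C` again and again and coincides with it, or the constraint is slack. -/
theorem IsVertex.finitelyValued_of_const_C (ha : I.IsVertex a) (hl : IsOneSided l)
    (hI : Ioo 0 I.H ∈ l) {κ : ℝ} (h : ∀ᶠ v in l, a Item.C v = κ) (X : Item) :
    FinitelyValued a l X := by
  by_cases hX : X = Item.C
  · subst hX; exact finitelyValued_of_eventually_eq h
  by_cases hf : ∃ᶠ v in l, utility a Item.C v = utility a X v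
  · obtain ⟨x, y, hJ, hsub⟩ := hl.exists_Ioo _ (inter_mem h hI)
    have htouch : ∀ e ∈ Ioo x y, utility a Item.C e = utility a X e → a X e = κ := by
      intro e he ht
      have heI := Ioo_subset_Icc_self (hsub he).2
      obtain ⟨v, hxv, hve⟩ := exists_between he.1
      obtain ⟨v', hev', hvy'⟩ := exists_between he.2
      have hv : v ∈ Ioo x y := ⟨hxv, hve.trans he.2⟩
      have hv' : v' ∈ Ioo x y := ⟨he.1.trans hev', hvy'⟩
      have h1 := (le_of_touch ha.1 heI ht (Ioo_subset_Icc_self (hsub hv).2)).1 hve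
      have h2 := (le_of_touch ha.1 heI ht (Ioo_subset_Icc_self (hsub hv').2)).2 hev'
      rw [(hsub hv).1] at h1
      rw [(hsub hv').1] at h2
      exact le_antisymm h2 h1
    refine finitelyValued_of_eventually_eq (κ := κ) ?_
    filter_upwards [hl.sandwich _ (hf.and_eventually hJ)] with v hv
    obtain ⟨e, e', hev, hve', ⟨ht, he⟩, ht', he'⟩ := hv
    exact le_antisymm (htouch e' he' ht' ▸ (ha.1.1 X).1 hve'.le)
      (htouch e he ht ▸ (ha.1.1 X).1 hev.le)
  · refine ha.finitelyValued_of_slack hl hI ?_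
    filter_upwards [eventually_utility_lt ha.1 hI hf] with v hv G hG hGX
    rcases hGX with h | rfl
    exacts [absurd h hX, hv]

/-- If only `u_X` may touch `u_C`, then `a X` and `a C` are finitely valued: along the touching points
`a X` is eventually constant, and this pins down both slopes in between. -/
theorem IsVertex.finitelyValued_of_others_slack (ha : I.IsVertex a) (hl : IsOneSided l)
    (hI : Ioo 0 I.H ∈ l) {X : Item}
    (h : ∀ᶠ v in l, ∀ G, G ≠ Item.C → G ≠ X → utility a G v < utility a Item.C v) :
    FinitelyValued a l Item.C ∧ FinitelyValued a l X := by
  by_cases hf : ∃ᶠ v in l, utility a Item.C v = utility a X v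
  · obtain ⟨x, y, hJ, hsub⟩ := hl.exists_Ioo _ (inter_mem h hI)
    have hfin := ha.finite_image_touch (X := X) (fun v hv => (hsub hv).2) fun v hv => (hsub hv).1
    obtain ⟨κ, hκ⟩ : ∃ κ, ∃ᶠ v in l,
        (v ∈ Ioo x y ∧ utility a Item.C v = utility a X v) ∧ a X v = κ := by
      by_contra hcon
      push Not at hcon
      have hev := (eventually_all_finite hfin).2 fun κ _ => hcon κ
      obtain ⟨v, ⟨ht, hv⟩, hno⟩ := ((hf.and_eventually hJ).and_eventually hev).exists
      exact hno (a X v) ⟨v, ⟨hv, ht⟩, rfl⟩ ⟨hv, ht⟩ rfl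
    have hev : ∀ᶠ v in l, a Item.C v = κ ∧ a X v = κ := by
      filter_upwards [hl.sandwich _ hκ, hI] with v hv hvI
      obtain ⟨e, e', hev, hve', ⟨⟨he, ht⟩, hκe⟩, ⟨he', ht'⟩, hκe'⟩ := hv
      have hvI := Ioo_subset_Icc_self hvI
      have h1 := (le_of_touch ha.1 (Ioo_subset_Icc_self (hsub he).2) ht hvI).2 hev
      have h2 := (le_of_touch ha.1 (Ioo_subset_Icc_self (hsub he').2) ht' hvI).1 hve'
      exact ⟨le_antisymm (h2.trans hκe'.le) (hκe.ge.trans h1),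
        le_antisymm (((ha.1.1 X).1 hve'.le).trans hκe'.le) (hκe.ge.trans ((ha.1.1 X).1 hev.le))⟩
    exact ⟨finitelyValued_of_eventually_eq (hev.mono fun v hv => hv.1),
      finitelyValued_of_eventually_eq (hev.mono fun v hv => hv.2)⟩
  · have hlt := eventually_utility_lt ha.1 hI hf
    constructor <;> refine ha.finitelyValued_of_slack hl hI ?_ <;>
      filter_upwards [hlt, h] with v hv hvG G hG hGX
    · by_cases hX : G = X
      · exact hX ▸ hv
      · exact hvG G hG hX
    · rcases hGX with rfl | rfl
      · exact absurd hv (lt_irrefl _)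
      · exact hv

/-- If the mass of one item does not accumulate at the limit of `l`, then a vertex is finitely valued
there. -/
theorem IsVertex.finitelyValued_of_const (ha : I.IsVertex a) (hl : IsOneSided l)
    (hI : Ioo 0 I.H ∈ l) {Y : Item} {κ : ℝ} (h : ∀ᶠ v in l, a Y v = κ) (G : Item) :
    FinitelyValued a l G := by
  by_cases hY : Y = Item.C
  · subst hY; exact ha.finitelyValued_of_const_C hl hI h G
  by_cases hf : ∃ᶠ v in l, utility a Item.C v = utility a Y v
  · refine ha.finitelyValued_of_const_C hl hI (κ := κ) ?_ G
    filter_upwards [hl.sandwich _ (hf.and_eventually (h.and hI)), hI] with v hv hvI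
    obtain ⟨e, e', hev, hve', ⟨ht, hκ, he⟩, ht', hκ', he'⟩ := hv
    have hvI := Ioo_subset_Icc_self hvI
    have h1 := (le_of_touch ha.1 (Ioo_subset_Icc_self he) ht hvI).2 hev
    have h2 := (le_of_touch ha.1 (Ioo_subset_Icc_self he') ht' hvI).1 hve'
    exact le_antisymm (h2.trans hκ'.le) (hκ.ge.trans h1)
  · have hlt := eventually_utility_lt ha.1 hI hf
    obtain ⟨X, hX, hall⟩ : ∃ X, (∀ G, G ≠ Item.C → G ≠ X → G = Y) ∧
        ∀ G, G = Item.C ∨ G = X ∨ G = Y := by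
      cases Y
      · exact ⟨Item.B, by rintro (_ | _ | _) <;> simp, by rintro (_ | _ | _) <;> simp⟩
      · exact ⟨Item.A, by rintro (_ | _ | _) <;> simp, by rintro (_ | _ | _) <;> simp⟩
      · exact absurd rfl hY
    obtain ⟨h1, h2⟩ := ha.finitelyValued_of_others_slack hl hI (X := X) (by
      filter_upwards [hlt] with v hv G hG hGX
      exact hX G hG hGX ▸ hv)
    rcases hall G with rfl | rfl | rfl
    exacts [h1, h2, finitelyValued_of_eventually_eq h]

end OneSided

/-! ### Accumulation of all three items -/

section Exchange

/-- If removing `ε g` from an optimal `a` leaves, up to the factor `1 - ε`, a feasible rule, then `g`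
is worth at least as much as `a`. That `g C` is the smallest makes the removal relax the utility
constraints; `g` itself need not be feasible. -/
theorem primalValue_le_of_exchange (ha : a ∈ I.feasibleSet)
    (hopt : ∀ b ∈ I.feasibleSet, I.primalValue b ≤ I.primalValue a) {g : Item → ℝ → ℝ}
    (hg : g ∈ monotoneAllocations) (hgC : ∀ G v, g Item.C v ≤ g G v) {ε : ℝ} (hε : 0 < ε)
    (hε1 : ε < 1) (hmono : ∀ G, Monotone fun v => a G v - ε * g G v)
    (hmem : ∀ G v, a G v - ε * g G v ∈ Icc 0 (1 - ε)) : I.primalValue a ≤ I.primalValue g := by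
  have hpos : 0 < 1 - ε := sub_pos.2 hε1
  set b : Item → ℝ → ℝ := fun G v => (1 - ε)⁻¹ * (a G v - ε * g G v) with hb
  have hbm : b ∈ monotoneAllocations := fun G => by
    refine ⟨(hmono G).const_mul (inv_nonneg.2 hpos.le), fun v => ⟨?_, ?_⟩⟩
    · exact mul_nonneg (inv_nonneg.2 hpos.le) (hmem G v).1
    · have := mul_le_mul_of_nonneg_left (hmem G v).2 (inv_nonneg.2 hpos.le)
      rwa [inv_mul_cancel₀ hpos.ne'] at this
  have hcombo : (1 - ε) • b + ε • g = a := by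
    ext G v
    simp only [Pi.add_apply, Pi.smul_apply, smul_eq_mul, hb]
    rw [mul_inv_cancel_left₀ hpos.ne']
    ring
  have hbf : b ∈ I.feasibleSet := by
    refine ⟨hbm, fun G v hv => ?_⟩
    have h1 := utility_combo hbm hg (1 - ε) ε G v
    have h2 := utility_combo hbm hg (1 - ε) ε Item.C v
    rw [hcombo] at h1 h2
    have h3 := ha.2 G v hv
    have h4 : utility g Item.C v ≤ utility g G v :=
      intervalIntegral.integral_mono hv.1 (monotoneUnit.intervalIntegrable (hg _) _ _)
        (monotoneUnit.intervalIntegrable (hg _) _ _) (hgC G)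
    refine le_of_mul_le_mul_left (a := 1 - ε) ?_ hpos
    nlinarith
  have h1 := I.primalValue_combo hbm hg (1 - ε) ε
  rw [hcombo] at h1
  have h2 := hopt b hbf
  nlinarith

/-- Exchange: cut a piece `[v G, w G]` of equal mass out of the price distribution of each item, the
piece of `C` lying above the others, and take the removed pieces as an allocation rule `g`. -/
theorem exists_localized_of_lt (ha : a ∈ I.feasibleSet)
    (hopt : ∀ b ∈ I.feasibleSet, I.primalValue b ≤ I.primalValue a) {v w : Item → ℝ}
    (hvw : ∀ G, a G (v G) < a G (w G)) (hC : ∀ G, G ≠ Item.C → w G ≤ v Item.C) :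
    ∃ g ∈ monotoneAllocations, I.primalValue a ≤ I.primalValue g ∧
      ∀ G, (∀ x ≤ v G, g G x = 0) ∧ ∀ x, w G ≤ x → g G x = 1 := by
  set D : Item → ℝ := fun G => a G (w G) - a G (v G) with hD
  have hDpos : ∀ G, 0 < D G := fun G => sub_pos.2 (hvw G)
  set T : Item → ℝ → ℝ := fun G => truncation (a G (v G)) (a G (w G)) with hT
  set g : Item → ℝ → ℝ := fun G x => (D G)⁻¹ * T G (a G x) with hgdef
  have hTnn : ∀ G s, 0 ≤ T G s := fun G s => sub_nonneg.2 (le_max_left _ _)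
  have hTle : ∀ G s, T G s ≤ D G := fun G s =>
    sub_le_sub_right (max_le (hvw G).le (min_le_right _ _)) _
  have hlow : ∀ G, ∀ x ≤ v G, g G x = 0 := fun G x hx => by
    simp only [hgdef, hT]
    rw [truncation_of_le ((ha.1 G).1 hx) (hvw G).le, mul_zero]
  have hhigh : ∀ G x, w G ≤ x → g G x = 1 := fun G x hx => by
    simp only [hgdef, hT]
    rw [truncation_of_ge ((ha.1 G).1 hx) (hvw G).le]
    exact inv_mul_cancel₀ (hDpos G).ne'
  have hg : g ∈ monotoneAllocations := fun G => by
    refine ⟨((monotone_truncation _ _).comp (ha.1 G).1).const_mul (inv_nonneg.2 (hDpos G).le),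
      fun x => ⟨mul_nonneg (inv_nonneg.2 (hDpos G).le) (hTnn G _), ?_⟩⟩
    have := mul_le_mul_of_nonneg_left (hTle G (a G x)) (inv_nonneg.2 (hDpos G).le)
    rwa [inv_mul_cancel₀ (hDpos G).ne'] at this
  have hgC : ∀ G x, g Item.C x ≤ g G x := fun G x => by
    by_cases hG : G = Item.C
    · subst hG; exact le_rfl
    rcases le_total x (v Item.C) with h | h
    · rw [hlow _ x h]; exact ((hg G).2 x).1
    · rw [hhigh G x ((hC G hG).trans h)]; exact ((hg _).2 x).2
  obtain ⟨ε, hε, hε1, hεD⟩ : ∃ ε : ℝ, 0 < ε ∧ ε < 1 ∧ ∀ G, ε ≤ D G := by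
    refine ⟨min (1 / 2) (min (D Item.A) (min (D Item.B) (D Item.C))), ?_, ?_, ?_⟩
    · exact lt_min (by norm_num) (lt_min (hDpos _) (lt_min (hDpos _) (hDpos _)))
    · exact (min_le_left _ _).trans_lt (by norm_num)
    · intro G
      refine (min_le_right _ _).trans ?_
      cases G <;> simp
  have hφ : ∀ G, Monotone fun s => s - ε * ((D G)⁻¹ * T G s) := fun G s t hst => by
    have h1 := truncation_sub_le (l := a G (v G)) (r := a G (w G)) hst
    have h2 : ε * (D G)⁻¹ ≤ 1 := by
      rw [← div_eq_mul_inv]; exact (div_le_one (hDpos G)).2 (hεD G)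
    have h3 : 0 ≤ T G t - T G s := sub_nonneg.2 (monotone_truncation _ _ hst)
    have h4 : ε * (D G)⁻¹ * (T G t - T G s) ≤ T G t - T G s := mul_le_of_le_one_left h3 h2
    change s - ε * ((D G)⁻¹ * T G s) ≤ t - ε * ((D G)⁻¹ * T G t)
    change T G t - T G s ≤ t - s at h1
    linarith
  have hφ0 : ∀ G, T G 0 = 0 := fun G => truncation_of_le ((ha.1 G).2 _).1 (hvw G).le
  have hφ1 : ∀ G, T G 1 = D G := fun G => truncation_of_ge ((ha.1 G).2 _).2 (hvw G).le
  refine ⟨g, hg, primalValue_le_of_exchange ha hopt hg hgC hε hε1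
    (fun G => (hφ G).comp (ha.1 G).1) (fun G x => ⟨?_, ?_⟩), fun G => ⟨hlow G, hhigh G⟩⟩
  · have := hφ G ((ha.1 G).2 x).1
    simpa [hφ0] using this
  · have := hφ G ((ha.1 G).2 x).2
    simpa only [hφ1, inv_mul_cancel₀ (hDpos G).ne', mul_one] using this

theorem exists_lt_of_not_eventually_const {b : ℝ → ℝ} {l : Filter ℝ} [l.NeBot]
    (h : ∀ κ, ¬∀ᶠ v in l, b v = κ) {s : Set ℝ} (hs : s ∈ l) :
    ∃ v ∈ s, ∃ w ∈ s, b v < b w := by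
  obtain ⟨v, hv⟩ := Filter.nonempty_of_mem hs
  by_contra hcon
  push Not at hcon
  refine h (b v) ?_
  filter_upwards [hs] with w hw
  exact le_antisymm (hcon v hv w hw) (hcon w hw v hv)

theorem const_mem_feasibleSet {b : ℝ → ℝ} (hb : b ∈ monotoneUnit) :
    (fun _ => b : Item → ℝ → ℝ) ∈ I.feasibleSet :=
  ⟨fun _ => hb, fun _ _ _ => le_rfl⟩

/-- If localized allocation rules worth at least `a` exist on arbitrarily short intervals, then so
does their limit, a single posted price. -/
theorem primalValue_le_of_tendsto {g : ℕ → Item → ℝ → ℝ} (hg : ∀ n, g n ∈ monotoneAllocations)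
    (hval : ∀ n, I.primalValue a ≤ I.primalValue (g n)) {b : ℝ → ℝ}
    (hlim : ∀ G v, ∀ᶠ n in atTop, g n G v = b v) :
    I.primalValue a ≤ I.primalValue fun _ => b := by
  have ht : Tendsto g atTop (𝓝 fun _ => b) := by
    rw [tendsto_pi_nhds]
    intro G
    rw [tendsto_pi_nhds]
    intro v
    exact (tendsto_congr' (hlim G v)).2 tendsto_const_nhds
  exact ((I.isClosed_setOf_le_primalValue _).mem_of_tendsto ht
    (.of_forall fun n => ⟨hg n, hval n⟩)).2

theorem indicator_Ioi_mem_monotoneUnit (p : ℝ) :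
    (Ioi p).indicator (fun _ => (1 : ℝ)) ∈ monotoneUnit := by
  refine ⟨fun v w hvw => ?_, fun v => ?_⟩
  · by_cases h : p < v
    · simp [h, h.trans_le hvw]
    · rw [indicator_of_notMem (by simpa using h)]
      exact indicator_nonneg (by simp) _
  · by_cases h : p < v <;> simp [h, indicator]

theorem tendsto_sub_one_div (p : ℝ) :
    Tendsto (fun n : ℕ => p - 1 / ((n : ℝ) + 1)) atTop (𝓝 p) := by
  simpa using (tendsto_const_nhds (x := p)).sub (tendsto_one_div_add_atTop_nhds_zero_nat (𝕜 := ℝ))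

theorem tendsto_add_one_div (p : ℝ) :
    Tendsto (fun n : ℕ => p + 1 / ((n : ℝ) + 1)) atTop (𝓝 p) := by
  simpa using (tendsto_const_nhds (x := p)).add (tendsto_one_div_add_atTop_nhds_zero_nat (𝕜 := ℝ))

/-- If the masses of all three items accumulate at `p` from the left, posting the price `p` for
every item is optimal. -/
theorem primalValue_le_posted_of_left (ha : a ∈ I.feasibleSet)
    (hopt : ∀ b ∈ I.feasibleSet, I.primalValue b ≤ I.primalValue a) {p : ℝ}
    (h : ∀ G κ, ¬∀ᶠ v in 𝓝[<] p, a G v = κ) :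
    I.primalValue a ≤ I.primalValue fun _ => (Ici p).indicator fun _ => 1 := by
  have hloc : ∀ n : ℕ, ∃ g ∈ monotoneAllocations, I.primalValue a ≤ I.primalValue g ∧
      ∀ G, (∀ x ≤ p - 1 / ((n : ℝ) + 1), g G x = 0) ∧ ∀ x, p ≤ x → g G x = 1 := by
    intro n
    have hn : p - 1 / ((n : ℝ) + 1) < p := sub_lt_self _ (by positivity)
    have hpair := fun G =>
      exists_lt_of_not_eventually_const (h G) (Ioo_mem_nhdsLT hn)
    choose v hv w hw hlt using hpair
    obtain ⟨v', hv', w', hw', hlt'⟩ := exists_lt_of_not_eventually_const (h Item.C) (Ioo_mem_nhdsLT (max_lt (hw Item.A).2 (hw Item.B).2))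
    have hlow : p - 1 / ((n : ℝ) + 1) ≤ v' :=
      ((hw Item.A).1.le.trans (le_max_left _ _)).trans hv'.1.le
    obtain ⟨g, hg, hval, hloc⟩ := exists_localized_of_lt ha hopt
      (v := Function.update v Item.C v') (w := Function.update w Item.C w')
      (by rintro (_ | _ | _) <;> simp [hlt, hlt'])
      (by
        rintro (_ | _ | _) hG
        · simpa using (le_max_left _ _).trans hv'.1.le
        · simpa using (le_max_right _ _).trans hv'.1.le
        · exact absurd rfl hG)
    refine ⟨g, hg, hval, fun G => ⟨fun x hx => (hloc G).1 x ?_, fun x hx => (hloc G).2 x ?_⟩⟩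
    · refine hx.trans ?_
      cases G
      · simpa using (hv Item.A).1.le
      · simpa using (hv Item.B).1.le
      · simpa using hlow
    · refine le_trans ?_ hx
      cases G
      · simpa using (hw Item.A).2.le
      · simpa using (hw Item.B).2.le
      · simpa using hw'.2.le
  choose g hg hval hg01 using hloc
  refine primalValue_le_of_tendsto hg hval fun G v => ?_
  rcases lt_or_ge v p with hv | hv
  · filter_upwards [(tendsto_sub_one_div p).eventually (lt_mem_nhds hv)] with n hn
    rw [(hg01 n G).1 v hn.le, indicator_of_notMem (by simpa using hv)]
  · exact .of_forall fun n => by rw [(hg01 n G).2 v hv, indicator_of_mem (by simpa using hv)]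

theorem primalValue_le_posted_of_right (ha : a ∈ I.feasibleSet)
    (hopt : ∀ b ∈ I.feasibleSet, I.primalValue b ≤ I.primalValue a) {p : ℝ}
    (h : ∀ G κ, ¬∀ᶠ v in 𝓝[>] p, a G v = κ) :
    I.primalValue a ≤ I.primalValue fun _ => (Ioi p).indicator fun _ => 1 := by
  have hloc : ∀ n : ℕ, ∃ g ∈ monotoneAllocations, I.primalValue a ≤ I.primalValue g ∧
      ∀ G, (∀ x ≤ p, g G x = 0) ∧ ∀ x, p + 1 / ((n : ℝ) + 1) ≤ x → g G x = 1 := by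
    intro n
    have hn : p < p + 1 / ((n : ℝ) + 1) := lt_add_of_pos_right _ (by positivity)
    obtain ⟨v', hv', w', hw', hlt'⟩ := exists_lt_of_not_eventually_const (h Item.C) (Ioo_mem_nhdsGT hn)
    have hpair := fun G =>
      exists_lt_of_not_eventually_const (h G) (Ioo_mem_nhdsGT hv'.1)
    choose v hv w hw hlt using hpair
    obtain ⟨g, hg, hval, hloc⟩ := exists_localized_of_lt ha hopt
      (v := Function.update v Item.C v') (w := Function.update w Item.C w')
      (by rintro (_ | _ | _) <;> simp [hlt, hlt'])
      (by
        rintro (_ | _ | _) hG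
        · simpa using (hw Item.A).2.le
        · simpa using (hw Item.B).2.le
        · exact absurd rfl hG)
    refine ⟨g, hg, hval, fun G => ⟨fun x hx => (hloc G).1 x ?_, fun x hx => (hloc G).2 x ?_⟩⟩
    · refine hx.trans ?_
      cases G
      · simpa using (hv Item.A).1.le
      · simpa using (hv Item.B).1.le
      · simpa using hv'.1.le
    · refine le_trans ?_ hx
      cases G
      · simpa using ((hw Item.A).2.trans hv'.2).le
      · simpa using ((hw Item.B).2.trans hv'.2).le
      · simpa using hw'.2.le
  choose g hg hval hg01 using hloc
  refine primalValue_le_of_tendsto hg hval fun G v => ?_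
  rcases le_or_gt v p with hv | hv
  · exact .of_forall fun n => by
      rw [(hg01 n G).1 v hv, indicator_of_notMem (by simpa using hv)]
  · filter_upwards [(tendsto_add_one_div p).eventually (gt_mem_nhds hv)] with n hn
    rw [(hg01 n G).2 v hn.le, indicator_of_mem (by simpa using hv)]

end Exchange

/-! ### Finite menus -/

theorem finite_range_indicator_one (S T : Set ℝ) :
    ((S.indicator fun _ => (1 : ℝ)) '' T).Finite := by
  refine (Set.toFinite {0, 1}).subset ?_
  rintro _ ⟨v, -, rfl⟩
  by_cases h : v ∈ S <;> simp [h]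

variable (I) in
/-- There is an optimal allocation rule with finitely many values: either a single posted price is
optimal, or an optimal vertex has finitely many values on both sides of every point, hence on the
compact interval `[0, H]`. -/
theorem exists_optimal_finite : ∃ a ∈ I.feasibleSet,
    (∀ b ∈ I.feasibleSet, I.primalValue b ≤ I.primalValue a) ∧
      ∀ G, (a G '' Icc 0 I.H).Finite := by
  obtain ⟨a, ha, hopt⟩ := I.exists_isVertex_optimal
  have hposted : ∀ {S : Set ℝ}, (S.indicator fun _ => (1 : ℝ)) ∈ monotoneUnit →
      I.primalValue a ≤ I.primalValue (fun _ => S.indicator fun _ => 1) →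
      ∃ a ∈ I.feasibleSet, (∀ b ∈ I.feasibleSet, I.primalValue b ≤ I.primalValue a) ∧
        ∀ G, (a G '' Icc 0 I.H).Finite := fun {S} hS hle =>
    ⟨_, const_mem_feasibleSet hS, fun b hb => (hopt b hb).trans hle,
      fun G => finite_range_indicator_one S _⟩
  by_cases hL : ∃ p, ∀ G κ, ¬∀ᶠ v in 𝓝[<] p, a G v = κ
  · obtain ⟨p, hp⟩ := hL
    exact hposted (step_mem_monotoneUnit p) (primalValue_le_posted_of_left ha.1 hopt hp)
  by_cases hR : ∃ p, ∀ G κ, ¬∀ᶠ v in 𝓝[>] p, a G v = κ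
  · obtain ⟨p, hp⟩ := hR
    exact hposted (indicator_Ioi_mem_monotoneUnit p) (primalValue_le_posted_of_right ha.1 hopt hp)
  push Not at hL hR
  refine ⟨a, ha.1, hopt, fun G => ?_⟩
  refine isCompact_Icc.induction_on (p := fun s => (a G '' s).Finite) (by simp)
    (fun s t hst ht => ht.subset (image_mono hst)) (fun s t hs ht => by
      rw [image_union]; exact hs.union ht) fun p hp => ?_
  have hleft : ∃ s ∈ 𝓝[<] p, (a G '' (s ∩ Icc 0 I.H)).Finite := by
    rcases hp.1.eq_or_lt with h0 | h0
    · refine ⟨Iio p, self_mem_nhdsWithin, ?_⟩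
      have : Iio p ∩ Icc 0 I.H = ∅ := by
        ext v; simp only [mem_inter_iff, mem_Iio, mem_Icc, mem_empty_iff_false, iff_false]
        intro h; linarith [h.1, h.2.1]
      simp [this]
    · obtain ⟨Y, κ, hY⟩ := hL p
      obtain ⟨s, hs, hfin⟩ := ha.finitelyValued_of_const (isOneSided_nhdsLT p)
        (mem_of_superset (Ioo_mem_nhdsLT h0) (Ioo_subset_Ioo_right hp.2)) hY G
      exact ⟨s, hs, hfin.subset (image_mono inter_subset_left)⟩
  have hright : ∃ s ∈ 𝓝[>] p, (a G '' (s ∩ Icc 0 I.H)).Finite := by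
    rcases hp.2.eq_or_lt with h0 | h0
    · refine ⟨Ioi p, self_mem_nhdsWithin, ?_⟩
      have : Ioi p ∩ Icc 0 I.H = ∅ := by
        ext v; simp only [mem_inter_iff, mem_Ioi, mem_Icc, mem_empty_iff_false, iff_false]
        intro h; linarith [h.1, h.2.2]
      simp [this]
    · obtain ⟨Y, κ, hY⟩ := hR p
      obtain ⟨s, hs, hfin⟩ := ha.finitelyValued_of_const (isOneSided_nhdsGT p)
        (mem_of_superset (Ioo_mem_nhdsGT h0) (Ioo_subset_Ioo_left hp.1)) hY G
      exact ⟨s, hs, hfin.subset (image_mono inter_subset_left)⟩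
  obtain ⟨s, hs, hsf⟩ := hleft
  obtain ⟨t, ht, htf⟩ := hright
  refine ⟨(s ∩ Icc 0 I.H) ∪ {p} ∪ (t ∩ Icc 0 I.H), ?_, ?_⟩
  · have hmem : s ∪ t ∈ 𝓝[≠] p := by
      rw [← nhdsLT_sup_nhdsGT]
      exact mem_sup.2 ⟨mem_of_superset hs subset_union_left, mem_of_superset ht subset_union_right⟩
    filter_upwards [self_mem_nhdsWithin,
      mem_nhdsWithin_of_mem_nhds (mem_nhdsWithin_iff_eventually.1 hmem)] with v hv hst
    by_cases hvp : v = p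
    · exact Or.inl (Or.inr hvp)
    · rcases hst hvp with h | h
      · exact Or.inl (Or.inl ⟨h, hv⟩)
      · exact Or.inr ⟨h, hv⟩
  · rw [image_union, image_union]
    exact (hsf.union (by simp)).union htf

theorem menuComplexity_lt_top {a : Item → ℝ → ℝ} (h : ∀ G, (a G '' Icc 0 I.H).Finite) :
    I.menuComplexity a < ⊤ := by
  rw [menuComplexity, encard_lt_top_iff]
  have h1 : ∀ G, ((fun q => (G, q)) '' (a G '' Icc 0 I.H)).Finite := fun G => (h G).image _
  refine ((h1 Item.A).union ((h1 Item.B).union (h1 Item.C))).subset ?_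
  rintro ⟨G, q⟩ ⟨v, hv, hq⟩
  cases G
  · exact Or.inl ⟨q, ⟨v, hv, hq⟩, rfl⟩
  · exact Or.inr (Or.inl ⟨q, ⟨v, hv, hq⟩, rfl⟩)
  · exact Or.inr (Or.inr ⟨q, ⟨v, hv, hq⟩, rfl⟩)

end AuctionInstance

end

theorem theorem2 (I : AuctionInstance) :
    (∀ d : DualSolution I, d.IsBest →
      ∃ a : Item → ℝ → ℝ,
        I.IsFeasible a ∧
        I.menuComplexity a < ⊤ ∧
        DualSolution.ComplementarySlackness a d ∧
        I.IsOptimalPrimal a ∧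
        I.IsOptimalMechanism (Mechanism.ofAlloc a)) ∧
    (∃ M : Mechanism, I.IsOptimalMechanism M ∧ I.menuComplexity M.alloc < ⊤) := by
  obtain ⟨a, ha, hopt, hfin⟩ := I.exists_optimal_finite
  have hprimal := AuctionInstance.isOptimalPrimal_of_mem ha hopt
  have hmenu := AuctionInstance.menuComplexity_lt_top hfin
  refine ⟨fun d hd => ⟨a, hprimal.1, hmenu, ?_, hprimal, hprimal.isOptimalMechanism⟩,
    Mechanism.ofAlloc a, hprimal.isOptimalMechanism, hmenu⟩
  refine d.complementarySlackness_of_value_le ha (le_of_forall_pos_le_add fun ε hε => ?_)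
  obtain ⟨d', hd'⟩ := AuctionInstance.exists_dual_value_le hopt hε
  exact (hd.1.1 d').trans hd'
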